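/- All graphs are finite. An $X,Y$-bigraph is a bipartite graph with parts $X$ and $Y$ in which multiple edges are allowed. For a vertex $v$ let $N(v)$ be the set of its neighbors, and for $S\subseteq X$ let $N(S)=\bigcup_{x\in S}N(x)$. A matching is a set of pairwise disjoint edges; $\alpha'(G)$ is the maximum number of edges in a matching, and $\Phi(G)$ is the number of maximum matchings, that is, matchings with $\alpha'(G)$ edges. Fix integers $n,t,r$ greater than $1$ and an integer $k\ge 0$. Let $G$ be an $X,Y$-bigraph with $|X|=n$ and $|Y|=n+t$, such that every vertex of $X$ has degree at least $k$ (counted with multiplicity) and at least $r$ distinct neighbors. Let $p=n-\alpha'(G)$, and let $S$ be a largest subset of $X$ such that $|N(S)|=|S|-p$. Assume that $S$ is nonempty and that every vertex of $Y\setminus N(S)$ has at least two distinct neighbors (as is the case when every vertex of $G$ has at least two neighbors). Let $n'=n-|S|$, and define $b'$ by letting $b'+2(n'+t+p)$ be the number of edges of the subgraph $G'=G-(S\cup N(S))$ obtained by deleting the vertices of $S\cup N(S)$. Then $$\Phi(G)\ \ge\ (k-r+1)\,\frac{(r+p)!}{p!}\,\bigl[(n'-1)(t+p)+2+b'\bigr]\,(t+p+1).$$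 -/

import Mathlib

/-- An `X,Y`-bigraph: a bipartite multigraph with parts `X` and `Y` and edge set `E`.
The edge `e` joins `e.left` in `X` to `e.right` in `Y`; distinct edges may be parallel. -/
structure Bigraph (X Y E : Type*) where
  /-- The endpoint in `X` of an edge. -/
  left : E → X
  /-- The endpoint in `Y` of an edge. -/
  right : E → Y

namespace Bigraph

open scoped Classical in
/-- `N(x)`: the set of neighbors of a vertex `x` of `X`. -/
noncomputable def nbrsX {X Y E : Type*} [Fintype Y] (G : Bigraph X Y E) (x : X) : Finset Y :=
  Finset.univ.filter fun y => ∃ e : E, G.left e = x ∧ G.right e = y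

open scoped Classical in
/-- `N(y)`: the set of neighbors of a vertex `y` of `Y`. -/
noncomputable def nbrsY {X Y E : Type*} [Fintype X] (G : Bigraph X Y E) (y : Y) : Finset X :=
  Finset.univ.filter fun x => ∃ e : E, G.left e = x ∧ G.right e = y

open scoped Classical in
/-- `N(S)`: the union of the neighborhoods of the vertices of a subset `S` of `X`. -/
noncomputable def nbrSet {X Y E : Type*} [Fintype Y] (G : Bigraph X Y E) (S : Finset X) :
    Finset Y :=
  S.biUnion fun x => G.nbrsX x

open scoped Classical in
/-- The degree of a vertex `x` of `X`: the number of edges at `x`, counted with multiplicity. -/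
noncomputable def degX {X Y E : Type*} [Fintype E] (G : Bigraph X Y E) (x : X) : ℕ :=
  (Finset.univ.filter fun e : E => G.left e = x).card

/-- A matching: a set of pairwise disjoint edges. -/
def IsMatching {X Y E : Type*} (G : Bigraph X Y E) (M : Finset E) : Prop :=
  ∀ e ∈ M, ∀ f ∈ M, e ≠ f → G.left e ≠ G.left f ∧ G.right e ≠ G.right f

open scoped Classical in
/-- `α'(G)`: the maximum number of edges in a matching. -/
noncomputable def matchingNumber {X Y E : Type*} [Fintype E] (G : Bigraph X Y E) : ℕ :=
  (Finset.univ.filter fun M : Finset E => G.IsMatching M).sup Finset.card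

/-- A maximum matching: a matching with the most edges. -/
def IsMaximumMatching {X Y E : Type*} (G : Bigraph X Y E) (M : Finset E) : Prop :=
  G.IsMatching M ∧ ∀ M' : Finset E, G.IsMatching M' → M'.card ≤ M.card

open scoped Classical in
/-- `Φ(G)`: the number of maximum matchings. -/
noncomputable def numMaximumMatchings {X Y E : Type*} [Fintype E] (G : Bigraph X Y E) : ℕ :=
  (Finset.univ.filter fun M : Finset E => G.IsMaximumMatching M).card

open scoped Classical in
/-- The edges of the subgraph obtained by deleting the vertices in `S ∪ T`,
for `S` a subset of `X` and `T` a subset of `Y`. -/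
noncomputable def edgesDelete {X Y E : Type*} [Fintype E] (G : Bigraph X Y E)
    (S : Finset X) (T : Finset Y) : Finset E :=
  Finset.univ.filter fun e : E => G.left e ∉ S ∧ G.right e ∉ T

end Bigraph

/-! The set `S` attains the deficiency `p`, so `|N(S)| + |X \ S| = α'(G)`. A matching of `N(S)` into
`S` together with a matching of `X \ S` into `Y \ N(S)` is therefore a maximum matching, and
different pairs give different unions. Hence `Φ(G)` is at least the product of the numbers of
saturating matchings on the two sides, and each side is bounded separately. Both are counted by
`satCount`, a rectangular permanent of the multiplicity matrix, with expansions along rows and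
columns.

On the side of `S`, every `U ⊆ S` has at least `|U| - p` neighbors. For `p = 0` this is a version of
Marshall Hall's bound in which parallel edges yield the factor `k - r + 1`
(`ColHall.mul_factorial_le_of_square`). The weight of a vertex of `S` is concentrated on exactly `r`
neighbors without raising the count, and then every excess parallel edge accounts for at least `(r -
1)!` matchings. For larger `p`, `ColHall.mul_factorial_le` averages over the deletion of a vertex of
a minimal tight set.

On the other side, maximality of `S` gives every nonempty set of rows a surplus of at least one, and
every column has two neighbors. `Surplus.mul_le_satCount` uses induction on the number of spare
columns, which is `t + p` in the end. If some set has surplus exactly one, a largest such set splits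
the graph, and edges crossing the split contribute additional matchings. If none has, deleting any
column preserves the hypotheses, and averaging over all columns gives the bound. The base case of
one spare column, `Surplus.two_mul_weightSum_le`, is the delicate one: deleting an edge destroys at
least two matchings, and when no edge can be deleted the graph is `K₂,₃` or has a row of degree two
that can be contracted. -/

/-! ### Permanent-like counting of saturating matchings. -/

section SaturatingCount

set_option linter.unusedSectionVars false

variable {α β : Type*} [DecidableEq α] [DecidableEq β]

/-- Adding a row `x` with weights `w x` to a counting function on sets of columns. -/
def addRow (w : α → β → ℕ) (x : α) (F : Finset β → ℕ) (B : Finset β) : ℕ :=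
  ∑ y ∈ B, w x y * F (B.erase y)

/-- Two rows may choose their distinct columns in either order. This makes `Multiset.foldr`
applicable, so the count needs no ordering of the rows. -/
instance addRow_leftCommutative (w : α → β → ℕ) : LeftCommutative (addRow w) where
  left_comm x z F := by
    funext B
    unfold addRow
    simp only [Finset.mul_sum]
    rw [Finset.sum_sigma', Finset.sum_sigma']
    refine Finset.sum_bij' (fun p _ => ⟨p.2, p.1⟩) (fun p _ => ⟨p.2, p.1⟩) ?_ ?_ ?_ ?_ ?_
    · rintro ⟨y, y'⟩ h
      simp only [Finset.mem_sigma, Finset.mem_erase] at h ⊢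
      exact ⟨h.2.2, h.2.1.symm, h.1⟩
    · rintro ⟨y, y'⟩ h
      simp only [Finset.mem_sigma, Finset.mem_erase] at h ⊢
      exact ⟨h.2.2, h.2.1.symm, h.1⟩
    · intros; rfl
    · intros; rfl
    · rintro ⟨y, y'⟩ h
      dsimp only
      rw [Finset.erase_right_comm]
      ring

/-- The number of matchings that saturate the rows `A` and use columns of `B`,
where `w x y` is the multiplicity of the edge joining the row `x` to the column `y`. -/
def satCount (w : α → β → ℕ) (A : Finset α) (B : Finset β) : ℕ :=
  A.val.foldr (addRow w) (fun _ => 1) B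

@[simp] lemma satCount_empty (w : α → β → ℕ) (B : Finset β) : satCount w ∅ B = 1 := rfl

lemma satCount_row (w : α → β → ℕ) {A : Finset α} (B : Finset β) {x : α} (hx : x ∈ A) :
    satCount w A B = ∑ y ∈ B, w x y * satCount w (A.erase x) (B.erase y) := by
  have h : A.val = x ::ₘ (A.erase x).val := by
    rw [← Finset.insert_val_of_notMem (Finset.notMem_erase x A), Finset.insert_erase hx]
  conv_lhs => rw [satCount, h, Multiset.foldr_cons]
  rfl

lemma satCount_insert (w : α → β → ℕ) {A : Finset α} (B : Finset β) {x : α} (hx : x ∉ A) :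
    satCount w (insert x A) B = ∑ y ∈ B, w x y * satCount w A (B.erase y) := by
  rw [satCount_row w B (Finset.mem_insert_self x A), Finset.erase_insert hx]

lemma satCount_congr {w w' : α → β → ℕ} {A : Finset α} {B : Finset β}
    (h : ∀ x ∈ A, ∀ y ∈ B, w x y = w' x y) : satCount w A B = satCount w' A B := by
  induction A using Finset.induction generalizing B with
  | empty => rfl
  | insert x A hx ih =>
    rw [satCount_insert w B hx, satCount_insert w' B hx]
    refine Finset.sum_congr rfl fun y hy => ?_
    rw [h x (Finset.mem_insert_self x A) y hy, ih fun z hz y' hy' =>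
      h z (Finset.mem_insert_of_mem hz) y' (Finset.mem_of_mem_erase hy')]

lemma satCount_mono (w : α → β → ℕ) (A : Finset α) {B B' : Finset β} (h : B ⊆ B') :
    satCount w A B ≤ satCount w A B' := by
  induction A using Finset.induction generalizing B B' with
  | empty => rfl
  | insert x A hx ih =>
    rw [satCount_insert w B hx, satCount_insert w B' hx]
    exact (Finset.sum_le_sum fun y _ => Nat.mul_le_mul_left _
      (ih (Finset.erase_subset_erase y h))).trans (Finset.sum_le_sum_of_subset h)

/-- Expansion along a column. -/
lemma satCount_col (w : α → β → ℕ) (A : Finset α) {B : Finset β} {y : β} (hy : y ∈ B) :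
    satCount w A B = satCount w A (B.erase y)
      + ∑ x ∈ A, w x y * satCount w (A.erase x) (B.erase y) := by
  induction A using Finset.induction generalizing B with
  | empty => simp
  | insert x A hx ih =>
    rw [satCount_insert w B hx, satCount_insert w (B.erase y) hx, Finset.sum_insert hx,
      Finset.erase_insert hx, ← Finset.add_sum_erase B _ hy]
    have h1 : ∀ z ∈ B.erase y, w x z * satCount w A (B.erase z)
        = w x z * satCount w A ((B.erase y).erase z) + ∑ x' ∈ A, w x' y *
          (w x z * satCount w (A.erase x') ((B.erase y).erase z)) := by
      intro z hz
      rw [ih (B := B.erase z) (by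
        simp only [Finset.mem_erase] at hz ⊢; exact ⟨hz.1.symm, hy⟩), mul_add, Finset.mul_sum,
        Finset.erase_right_comm]
      congr 1
      exact Finset.sum_congr rfl fun _ _ => by ring
    rw [Finset.sum_congr rfl h1, Finset.sum_add_distrib, Finset.sum_comm]
    have h2 : ∀ x' ∈ A, ∑ z ∈ B.erase y, w x' y *
          (w x z * satCount w (A.erase x') ((B.erase y).erase z))
        = w x' y * satCount w ((insert x A).erase x') (B.erase y) := by
      intro x' hx'
      have hne : x ≠ x' := fun h => hx (h ▸ hx')
      rw [Finset.erase_insert_of_ne hne,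
        satCount_insert w _ (fun h => hx (Finset.mem_of_mem_erase h)), Finset.mul_sum]
    rw [Finset.sum_congr rfl h2]
    ring

/-- Double counting the pairs of a saturating matching and a column it avoids. -/
lemma sum_satCount_erase (w : α → β → ℕ) (A : Finset α) (B : Finset β) :
    ∑ y ∈ B, satCount w A (B.erase y) + A.card * satCount w A B = B.card * satCount w A B := by
  induction A using Finset.induction generalizing B with
  | empty => simp
  | insert x A hx ih =>
    have h1 : ∑ y ∈ B, satCount w (insert x A) (B.erase y)
        = ∑ z ∈ B, w x z * ∑ y ∈ B.erase z, satCount w A ((B.erase z).erase y) := by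
      simp only [satCount_insert w _ hx, Finset.mul_sum]
      rw [Finset.sum_sigma', Finset.sum_sigma']
      refine Finset.sum_bij' (fun p _ => ⟨p.2, p.1⟩) (fun p _ => ⟨p.2, p.1⟩) ?_ ?_ ?_ ?_ ?_
      · rintro ⟨y, y'⟩ h
        simp only [Finset.mem_sigma, Finset.mem_erase] at h ⊢
        exact ⟨h.2.2, h.2.1.symm, h.1⟩
      · rintro ⟨y, y'⟩ h
        simp only [Finset.mem_sigma, Finset.mem_erase] at h ⊢
        exact ⟨h.2.2, h.2.1.symm, h.1⟩
      · intros; rfl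
      · intros; rfl
      · rintro ⟨y, y'⟩ h
        dsimp only
        rw [Finset.erase_right_comm]
    rw [h1, satCount_insert w B hx, Finset.card_insert_of_notMem hx, Finset.mul_sum,
      Finset.mul_sum, ← Finset.sum_add_distrib]
    refine Finset.sum_congr rfl fun z hz => ?_
    have h2 := ih (B.erase z)
    have h3 := Finset.card_erase_add_one hz
    rw [← h3]
    linear_combination w x z * h2

lemma sum_satCount_erase_eq (w : α → β → ℕ) {A : Finset α} {B : Finset β} {T : ℕ}
    (h : B.card = A.card + T) :
    ∑ y ∈ B, satCount w A (B.erase y) = T * satCount w A B := by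
  have := sum_satCount_erase w A B
  rw [h] at this
  linarith [add_mul A.card T (satCount w A B)]

lemma satCount_pos_of_injOn (w : α → β → ℕ) {A : Finset α} {B : Finset β} (f : α → β)
    (hf : Set.InjOn f A) (hB : ∀ x ∈ A, f x ∈ B) (hw : ∀ x ∈ A, 0 < w x (f x)) :
    0 < satCount w A B := by
  induction A using Finset.induction generalizing B with
  | empty => simp
  | insert x A hx ih =>
    rw [satCount_insert w B hx]
    have h1 : 0 < satCount w A (B.erase (f x)) := by
      refine ih (hf.mono (by simp)) (fun z hz => ?_)
        fun z hz => hw z (Finset.mem_insert_of_mem hz)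
      refine Finset.mem_erase.2 ⟨fun h => hx ?_, hB z (Finset.mem_insert_of_mem hz)⟩
      have := hf (by simp [hz]) (by simp) h
      exact this ▸ hz
    exact (Nat.mul_pos (hw x (Finset.mem_insert_self x A)) h1).trans_le
      (Finset.single_le_sum (f := fun y => w x y * satCount w A (B.erase y))
        (fun _ _ => Nat.zero_le _) (hB x (Finset.mem_insert_self x A)))

/-- The rows of `A₁` may be matched into `B₁` and the others into the rest. -/
lemma satCount_mul_le (w : α → β → ℕ) {A A₁ : Finset α} {B B₁ : Finset β}
    (hA : A₁ ⊆ A) (hB : B₁ ⊆ B) :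
    satCount w A₁ B₁ * satCount w (A \ A₁) (B \ B₁) ≤ satCount w A B := by
  induction A₁ using Finset.induction generalizing A B B₁ with
  | empty => simpa using satCount_mono w A Finset.sdiff_subset
  | insert x A₁ hx ih =>
    have hxA : x ∈ A := hA (Finset.mem_insert_self x A₁)
    rw [satCount_insert w B₁ hx, satCount_row w B hxA, Finset.sum_mul]
    refine le_trans (Finset.sum_le_sum fun y hy => ?_) (Finset.sum_le_sum_of_subset hB)
    rw [mul_assoc]
    refine Nat.mul_le_mul_left _ (le_trans (le_of_eq ?_) (ih (A := A.erase x) (B := B.erase y)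
      (B₁ := B₁.erase y) ?_ (Finset.erase_subset_erase y hB)))
    · congr 2
      · ext z; simp only [Finset.mem_sdiff, Finset.mem_insert, Finset.mem_erase]; tauto
      · ext z
        simp only [Finset.mem_sdiff, Finset.mem_erase]
        have : z = y → z ∈ B₁ := fun h => h ▸ hy
        tauto
    · intro z hz
      exact Finset.mem_erase.2 ⟨fun h => hx (h ▸ hz), hA (Finset.mem_insert_of_mem hz)⟩

/-- If `B₁` has one more element than `A₁`, then `A₁` may be matched to all but one
of the columns of `B₁`, leaving that column to the other rows. -/
lemma sum_satCount_mul_le (w : α → β → ℕ) {A A₁ : Finset α} {B B₁ : Finset β}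
    (hA : A₁ ⊆ A) (hB : B₁ ⊆ B) (hc : B₁.card = A₁.card + 1) :
    ∑ y ∈ B₁, satCount w A₁ (B₁.erase y) * satCount w (A \ A₁) (insert y (B \ B₁))
      ≤ satCount w A B := by
  induction A₁ using Finset.induction generalizing A B B₁ with
  | empty =>
    obtain ⟨y, rfl⟩ := Finset.card_eq_one.1 (by simpa using hc)
    have hy : y ∈ B := hB (Finset.mem_singleton_self y)
    simp [Finset.sdiff_singleton_eq_erase, Finset.insert_erase hy]
  | insert x A₁ hx ih =>
    have hxA : x ∈ A := hA (Finset.mem_insert_self x A₁)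
    have h1 : ∀ z ∈ B₁, ∑ y ∈ B₁.erase z, w x z * (satCount w A₁ ((B₁.erase z).erase y) *
        satCount w (A \ insert x A₁) (insert y (B \ B₁)))
        ≤ w x z * satCount w (A.erase x) (B.erase z) := by
      intro z hz
      rw [← Finset.mul_sum]
      refine Nat.mul_le_mul_left _ (le_trans (le_of_eq ?_) (ih (A := A.erase x) (B := B.erase z)
        (B₁ := B₁.erase z) ?_ (Finset.erase_subset_erase z hB) ?_))
      · refine Finset.sum_congr rfl fun y _ => ?_
        congr 2
        · ext u; simp only [Finset.mem_sdiff, Finset.mem_insert, Finset.mem_erase]; tauto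
        · congr 1
          ext u
          simp only [Finset.mem_sdiff, Finset.mem_erase]
          have : u = z → u ∈ B₁ := fun h => h ▸ hz
          tauto
      · intro u hu
        exact Finset.mem_erase.2 ⟨fun h => hx (h ▸ hu), hA (Finset.mem_insert_of_mem hu)⟩
      · rw [Finset.card_erase_of_mem hz, hc, Finset.card_insert_of_notMem hx]; rfl
    rw [satCount_row w B hxA]
    refine le_trans (le_of_eq ?_) ((Finset.sum_le_sum h1).trans (Finset.sum_le_sum_of_subset hB))
    simp only [satCount_insert w _ hx, Finset.sum_mul]
    rw [Finset.sum_sigma', Finset.sum_sigma']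
    refine Finset.sum_bij' (fun p _ => ⟨p.2, p.1⟩) (fun p _ => ⟨p.2, p.1⟩) ?_ ?_ ?_ ?_ ?_
    · rintro ⟨y, y'⟩ h
      simp only [Finset.mem_sigma, Finset.mem_erase] at h ⊢
      exact ⟨h.2.2, h.2.1.symm, h.1⟩
    · rintro ⟨y, y'⟩ h
      simp only [Finset.mem_sigma, Finset.mem_erase] at h ⊢
      exact ⟨h.2.2, h.2.1.symm, h.1⟩
    · intros; rfl
    · intros; rfl
    · rintro ⟨y, y'⟩ h
      dsimp only
      rw [Finset.erase_right_comm]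
      ring

/-- Removing one copy of the edge `x y`. -/
def decEdge (w : α → β → ℕ) (x : α) (y : β) (a : α) (b : β) : ℕ :=
  if a = x ∧ b = y then w a b - 1 else w a b

lemma decEdge_self (w : α → β → ℕ) (x : α) (y : β) : decEdge w x y x y = w x y - 1 := by
  simp [decEdge]

lemma decEdge_of_left_ne (w : α → β → ℕ) {x a : α} (y b : β) (h : a ≠ x) :
    decEdge w x y a b = w a b := by
  simp [decEdge, h]

lemma decEdge_of_right_ne (w : α → β → ℕ) (x a : α) {y b : β} (h : b ≠ y) :
    decEdge w x y a b = w a b := by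
  simp [decEdge, h]

/-- The saturating matchings are sorted by whether they use the one removed copy of the edge.
Inductions on the number of edges rest on bounding the second summand from below. -/
lemma satCount_decEdge (w : α → β → ℕ) {A : Finset α} {B : Finset β} {x : α} {y : β}
    (hx : x ∈ A) (hy : y ∈ B) (hw : 0 < w x y) :
    satCount w A B = satCount (decEdge w x y) A B + satCount w (A.erase x) (B.erase y) := by
  have hc : ∀ b, satCount (decEdge w x y) (A.erase x) (B.erase b)
      = satCount w (A.erase x) (B.erase b) := fun b =>
    satCount_congr fun a ha b _ => decEdge_of_left_ne w y b (Finset.ne_of_mem_erase ha)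
  rw [satCount_row w B hx, satCount_row (decEdge w x y) B hx, ← Finset.add_sum_erase B _ hy,
    ← Finset.add_sum_erase B _ hy, hc, decEdge_self]
  have : ∀ b ∈ B.erase y, decEdge w x y x b * satCount (decEdge w x y) (A.erase x) (B.erase b)
      = w x b * satCount w (A.erase x) (B.erase b) := fun b hb => by
    rw [hc, decEdge_of_right_ne w x x (Finset.ne_of_mem_erase hb)]
  rw [Finset.sum_congr rfl this]
  obtain ⟨k, hk⟩ : ∃ k, w x y = k + 1 := ⟨w x y - 1, by omega⟩
  rw [hk]
  simp only [Nat.add_sub_cancel]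
  ring

/-- The total weight between `A` and `B`. -/
def weightSum (w : α → β → ℕ) (A : Finset α) (B : Finset β) : ℕ := ∑ x ∈ A, ∑ y ∈ B, w x y

lemma weightSum_decEdge (w : α → β → ℕ) {A : Finset α} {B : Finset β} {x : α} {y : β}
    (hx : x ∈ A) (hy : y ∈ B) (hw : 0 < w x y) :
    weightSum w A B = weightSum (decEdge w x y) A B + 1 := by
  unfold weightSum
  rw [← Finset.add_sum_erase A _ hx, ← Finset.add_sum_erase A _ hx, ← Finset.add_sum_erase B _ hy,
    ← Finset.add_sum_erase B _ hy, decEdge_self]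
  rw [Finset.sum_congr rfl fun a ha => Finset.sum_congr rfl fun b _ =>
    decEdge_of_left_ne w y b (Finset.ne_of_mem_erase ha),
    Finset.sum_congr rfl fun b hb => decEdge_of_right_ne w x x (Finset.ne_of_mem_erase hb)]
  omega

end SaturatingCount

/-! ### Hall-type surplus, tight sets and first lower bounds. -/

section Surplus

set_option linter.unusedSectionVars false

variable {α β : Type*} [DecidableEq α] [DecidableEq β]

/-- The columns of `B` adjacent to some row of `S`. -/
def nb (w : α → β → ℕ) (B : Finset β) (S : Finset α) : Finset β :=
  B.filter fun y => ∃ x ∈ S, 0 < w x y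

/-- The rows of `A` adjacent to the column `y`. -/
def rowNb (w : α → β → ℕ) (A : Finset α) (y : β) : Finset α :=
  A.filter fun x => 0 < w x y

/-- Every nonempty `S ⊆ A` has at least `|S| + c` neighbors in `B`. -/
def Surplus (w : α → β → ℕ) (A : Finset α) (B : Finset β) (c : ℕ) : Prop :=
  ∀ S ⊆ A, S.Nonempty → S.card + c ≤ (nb w B S).card

lemma mem_nb {w : α → β → ℕ} {B : Finset β} {S : Finset α} {y : β} :
    y ∈ nb w B S ↔ y ∈ B ∧ ∃ x ∈ S, 0 < w x y := Finset.mem_filter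

lemma mem_rowNb {w : α → β → ℕ} {A : Finset α} {x : α} {y : β} :
    x ∈ rowNb w A y ↔ x ∈ A ∧ 0 < w x y := Finset.mem_filter

lemma nb_subset (w : α → β → ℕ) (B : Finset β) (S : Finset α) : nb w B S ⊆ B :=
  Finset.filter_subset _ _

lemma nb_mono (w : α → β → ℕ) (B : Finset β) {S S' : Finset α} (h : S ⊆ S') :
    nb w B S ⊆ nb w B S' := fun y hy => by
  rw [mem_nb] at *
  exact ⟨hy.1, hy.2.imp fun x hx => ⟨h hx.1, hx.2⟩⟩

lemma nb_union (w : α → β → ℕ) (B : Finset β) (S S' : Finset α) :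
    nb w B (S ∪ S') = nb w B S ∪ nb w B S' := by
  ext y
  simp only [mem_nb, Finset.mem_union, or_and_right, exists_or, and_or_left]

lemma nb_sdiff (w : α → β → ℕ) (B C : Finset β) (S : Finset α) :
    nb w (B \ C) S = nb w B S \ C := by
  ext y
  simp only [mem_nb, Finset.mem_sdiff]; tauto

lemma nb_erase (w : α → β → ℕ) (B : Finset β) (y : β) (S : Finset α) :
    nb w (B.erase y) S = (nb w B S).erase y := by
  ext z
  simp only [mem_nb, Finset.mem_erase]; tauto

lemma card_nb_union_add_card_nb_inter_le (w : α → β → ℕ) (B : Finset β) (S S' : Finset α) :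
    (nb w B (S ∪ S')).card + (nb w B (S ∩ S')).card ≤ (nb w B S).card + (nb w B S').card := by
  rw [nb_union, ← Finset.card_union_add_card_inter (nb w B S)]
  refine Nat.add_le_add_left (Finset.card_le_card ?_) _
  exact Finset.subset_inter (nb_mono w B Finset.inter_subset_left)
    (nb_mono w B Finset.inter_subset_right)

lemma card_nb_sdiff_add (w : α → β → ℕ) (B : Finset β) (S S' : Finset α) :
    (nb w (B \ nb w B S) S').card + (nb w B S).card = (nb w B (S ∪ S')).card := by
  rw [nb_sdiff, nb_union, Finset.card_sdiff_add_card, Finset.union_comm]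

lemma Surplus.mono_left {w : α → β → ℕ} {A A' : Finset α} {B : Finset β} {c : ℕ}
    (h : Surplus w A B c) (hA : A' ⊆ A) : Surplus w A' B c :=
  fun S hS => h S (hS.trans hA)

lemma Surplus.mono {w : α → β → ℕ} {A : Finset α} {B : Finset β} {c c' : ℕ}
    (h : Surplus w A B c) (hc : c' ≤ c) : Surplus w A B c' :=
  fun S hS hne => by have := h S hS hne; omega

lemma Surplus.erase_right {w : α → β → ℕ} {A : Finset α} {B : Finset β} {c : ℕ}
    (h : Surplus w A B (c + 1)) (y : β) : Surplus w A (B.erase y) c := fun S hS hne => by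
  have h1 := h S hS hne
  have h2 := Finset.pred_card_le_card_erase (s := nb w B S) (a := y)
  rw [nb_erase]; omega

lemma Surplus.nb_self {w : α → β → ℕ} {A S : Finset α} {B : Finset β} {c : ℕ}
    (h : Surplus w A B c) (hS : S ⊆ A) : Surplus w S (nb w B S) c := fun S' hS' hne => by
  have h1 := h S' (hS'.trans hS) hne
  have : nb w (nb w B S) S' = nb w B S' := by
    ext y
    simp only [mem_nb]
    exact ⟨fun h => ⟨h.1.1, h.2⟩, fun h => ⟨⟨h.1, h.2.imp fun x hx => ⟨hS' hx.1, hx.2⟩⟩, h.2⟩⟩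
  rwa [this]

/-- Deleting a tight set with its neighborhood preserves Hall's condition. -/
lemma Surplus.sdiff {w : α → β → ℕ} {A S : Finset α} {B : Finset β} {c : ℕ}
    (h : Surplus w A B c) (hS : S ⊆ A) (ht : (nb w B S).card = S.card + c) :
    Surplus w (A \ S) (B \ nb w B S) 0 := fun S' hS' hne => by
  have h1 := card_nb_sdiff_add w B S S'
  have h2 := h (S ∪ S') (Finset.union_subset hS (hS'.trans Finset.sdiff_subset))
    (hne.mono Finset.subset_union_right)
  have h3 : (S ∪ S').card = S.card + S'.card :=
    Finset.card_union_of_disjoint (Finset.disjoint_of_subset_right hS' Finset.disjoint_sdiff)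
  omega

/-- A largest tight set leaves positive surplus behind. -/
lemma Surplus.exists_maximal_tight {w : α → β → ℕ} {A S₀ : Finset α} {B : Finset β} {c : ℕ}
    (h : Surplus w A B c) (h₀ : S₀ ⊆ A) (hne₀ : S₀.Nonempty)
    (ht₀ : (nb w B S₀).card = S₀.card + c) :
    ∃ S ⊆ A, S.Nonempty ∧ (nb w B S).card = S.card + c ∧
      Surplus w (A \ S) (B \ nb w B S) 1 := by
  obtain ⟨S, hS, hmax⟩ := Finset.exists_max_image
    (A.powerset.filter fun S => S.Nonempty ∧ (nb w B S).card = S.card + c) Finset.card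
    ⟨S₀, by simp [h₀, hne₀, ht₀]⟩
  simp only [Finset.mem_filter, Finset.mem_powerset] at hS hmax
  refine ⟨S, hS.1, hS.2.1, hS.2.2, fun S' hS' hne => ?_⟩
  have h1 := card_nb_sdiff_add w B S S'
  have hsub : S ∪ S' ⊆ A := Finset.union_subset hS.1 (hS'.trans Finset.sdiff_subset)
  have hne' : (S ∪ S').Nonempty := hne.mono Finset.subset_union_right
  have h2 := h (S ∪ S') hsub hne'
  have h3 : (S ∪ S').card = S.card + S'.card :=
    Finset.card_union_of_disjoint (Finset.disjoint_of_subset_right hS' Finset.disjoint_sdiff)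
  have h4 := Finset.card_pos.2 hne
  have h5 : (nb w B (S ∪ S')).card ≠ (S ∪ S').card + c := fun h6 => by
    have := hmax (S ∪ S') ⟨hsub, hne', h6⟩
    omega
  have h7 := hS.2.2
  omega

/-- Intersecting tight sets have a tight intersection. -/
lemma Surplus.tight_inter {w : α → β → ℕ} {A S S' : Finset α} {B : Finset β} {c : ℕ}
    (h : Surplus w A B c) (hS : S ⊆ A) (hS' : S' ⊆ A) (hne : (S ∩ S').Nonempty)
    (ht : (nb w B S).card = S.card + c) (ht' : (nb w B S').card = S'.card + c) :
    (nb w B (S ∩ S')).card = (S ∩ S').card + c := by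
  have h1 := h (S ∩ S') (Finset.inter_subset_left.trans hS) hne
  have h2 := h (S ∪ S') (Finset.union_subset hS hS')
    (hne.mono (Finset.inter_subset_left.trans Finset.subset_union_left))
  have h3 := card_nb_union_add_card_nb_inter_le w B S S'
  have h4 := Finset.card_union_add_card_inter S S'
  omega

/-- This is Hall's marriage theorem on the subtype of rows, with the resulting injection read as one
term of the permanent. -/
lemma Surplus.satCount_pos {w : α → β → ℕ} {A : Finset α} {B : Finset β}
    (h : Surplus w A B 0) : 0 < satCount w A B := by
  rcases A.eq_empty_or_nonempty with rfl | hA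
  · simp
  have hall : ∀ s : Finset A, s.card ≤ (s.biUnion fun x => nb w B {x.1}).card := by
    intro s
    rcases s.eq_empty_or_nonempty with rfl | hs
    · simp
    have h1 := h (s.map (Function.Embedding.subtype _)) (fun x hx => by
      simp only [Finset.mem_map, Function.Embedding.subtype_apply] at hx
      obtain ⟨a, -, rfl⟩ := hx; exact a.2) (by simpa using hs)
    rw [Finset.card_map] at h1
    refine h1.trans (Finset.card_le_card fun y hy => ?_)
    simp only [mem_nb, Finset.mem_map, Function.Embedding.subtype_apply, Finset.mem_biUnion] at hy ⊢
    obtain ⟨hy, x, ⟨a, ha, rfl⟩, hx⟩ := hy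
    exact ⟨a, ha, hy, a, by simp, hx⟩
  obtain ⟨f, hf, hfm⟩ := (Finset.all_card_le_biUnion_card_iff_exists_injective _).1 hall
  obtain ⟨a, ha⟩ := hA
  have hmem : ∀ x (hx : x ∈ A), f ⟨x, hx⟩ ∈ B ∧ 0 < w x (f ⟨x, hx⟩) := fun x hx => by
    have := hfm ⟨x, hx⟩
    simpa [mem_nb] using this
  -- The value outside `A` is a dummy, since injectivity is needed on `A` only.
  refine satCount_pos_of_injOn w (fun x => if hx : x ∈ A then f ⟨x, hx⟩ else f ⟨a, ha⟩)
    ?_ ?_ ?_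
  · intro x hx z hz hxz
    simp only [Finset.mem_coe] at hx hz
    simp only [hx, hz, dite_true] at hxz
    simpa using hf hxz
  · intro x hx
    simpa [hx] using (hmem x hx).1
  · intro x hx
    simpa [hx] using (hmem x hx).2

/-- A positive surplus persists unless the deleted edge is the only one
from a tight set to its column. -/
lemma Surplus.decEdge_or {w : α → β → ℕ} {A : Finset α} {B : Finset β} {c : ℕ}
    (h : Surplus w A B c) {x : α} {y : β} :
    Surplus (decEdge w x y) A B c ∨ (w x y ≤ 1 ∧ ∃ S ⊆ A, x ∈ S ∧ (nb w B S).card = S.card + c ∧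
      ∀ z ∈ S, z ≠ x → w z y = 0) := by
  by_contra hcon
  push Not at hcon
  obtain ⟨h1, h2⟩ := hcon
  refine h1 fun S hS hne => ?_
  by_contra hlt
  have hsub : (nb w B S).erase y ⊆ nb (decEdge w x y) B S := fun z hz => by
    rw [Finset.mem_erase, mem_nb] at hz
    obtain ⟨hzy, hzB, a, ha, haz⟩ := hz
    exact mem_nb.2 ⟨hzB, a, ha, by rwa [decEdge_of_right_ne w x a hzy]⟩
  have hS1 := h S hS hne
  have hc := Finset.card_le_card hsub
  have hc' := Finset.pred_card_le_card_erase (s := nb w B S) (a := y)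
  have hy : y ∈ nb w B S ∧ y ∉ nb (decEdge w x y) B S := by
    by_contra hy
    have : nb w B S ⊆ nb (decEdge w x y) B S := fun z hz => by
      by_cases hzy : z = y
      · subst hzy
        by_contra h3
        exact hy ⟨hz, h3⟩
      · exact hsub (Finset.mem_erase.2 ⟨hzy, hz⟩)
    have := Finset.card_le_card this
    omega
  obtain ⟨hyB, a, ha, hay⟩ := mem_nb.1 hy.1
  have hz : ∀ z ∈ S, decEdge w x y z y = 0 := fun z hz => by
    by_contra h3
    exact hy.2 (mem_nb.2 ⟨hyB, z, hz, Nat.pos_of_ne_zero h3⟩)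
  have hz' : ∀ z ∈ S, z ≠ x → w z y = 0 := fun z hzS hzx => by
    have := hz z hzS
    rwa [decEdge_of_left_ne w y y hzx] at this
  have hax : a = x := by
    by_contra hax
    have := hz' a ha hax
    omega
  subst hax
  have h3 := hz a ha
  rw [decEdge_self] at h3
  obtain ⟨z, hzS, hza, hzw⟩ := h2 (by omega) S hS ha (by omega)
  exact hzw (hz' z hzS hza)

/-- With one spare column and no isolated column there are two saturating matchings. -/
lemma two_le_satCount_of_covered {w : α → β → ℕ} {A : Finset α} {B : Finset β}
    (h : Surplus w A B 0) (hc : B.card = A.card + 1) (hcov : ∀ y ∈ B, (rowNb w A y).Nonempty) :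
    2 ≤ satCount w A B := by
  have hpos := h.satCount_pos
  have hsum := sum_satCount_erase_eq w hc
  -- Some saturating matching avoids a column `y`. Rerouting a row adjacent to `y` gives a second
  -- matching, one that uses `y`.
  obtain ⟨y, hy, hy0⟩ : ∃ y ∈ B, 0 < satCount w A (B.erase y) := by
    by_contra hcon
    push Not at hcon
    have := Finset.sum_eq_zero fun y hy => Nat.le_zero.1 (hcon y hy)
    omega
  obtain ⟨x, hx⟩ := hcov y hy
  rw [mem_rowNb] at hx
  have h1 : 0 < satCount w (A.erase x) (B.erase y) := by
    rw [satCount_row w _ hx.1] at hy0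
    obtain ⟨z, -, hz⟩ := Finset.exists_ne_zero_of_sum_ne_zero hy0.ne'
    exact (Nat.pos_of_ne_zero (right_ne_zero_of_mul hz)).trans_le
      (satCount_mono w _ (Finset.erase_subset _ _))
  have h2 : w x y * satCount w (A.erase x) (B.erase y)
      ≤ ∑ x ∈ A, w x y * satCount w (A.erase x) (B.erase y) :=
    Finset.single_le_sum (f := fun x => w x y * satCount w (A.erase x) (B.erase y))
      (fun _ _ => Nat.zero_le _) hx.1
  rw [satCount_col w A hy]
  have h3 := Nat.mul_pos hx.2 h1
  omega

/-- A column outside the neighborhood of `S` has no neighbor in `S`, so degree conditions on columns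
survive the deletion of `S` and its neighbors. -/
lemma rowNb_sdiff_eq {w : α → β → ℕ} {A S : Finset α} {B : Finset β} {y : β}
    (hy : y ∈ B \ nb w B S) : rowNb w (A \ S) y = rowNb w A y := by
  ext x
  simp only [mem_rowNb, Finset.mem_sdiff, mem_nb] at hy ⊢
  exact ⟨fun h => ⟨h.1.1, h.2⟩, fun h => ⟨⟨h.1, fun hxS => hy.2 ⟨hy.1, x, hxS, h.2⟩⟩, h.2⟩⟩

/-- The sum over a column is at least the sum over two of its rows. -/
lemma sum_two_le {ι : Type*} [DecidableEq ι] {s : Finset ι} {f : ι → ℕ} {a b : ι} (ha : a ∈ s)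
    (hb : b ∈ s) (hab : a ≠ b) : f a + f b ≤ ∑ i ∈ s, f i := by
  rw [← Finset.sum_pair hab]
  exact Finset.sum_le_sum_of_subset (by
    intro i hi; simp only [Finset.mem_insert, Finset.mem_singleton] at hi
    rcases hi with rfl | rfl <;> assumption)

/-- A nonempty square leafless bipartite graph with a perfect matching has at least two. -/
lemma two_le_satCount_of_leafless (w : α → β → ℕ) {A : Finset α} {B : Finset β}
    (h : Surplus w A B 0) (hc : B.card = A.card) (hA : B.Nonempty)
    (hleaf : ∀ y ∈ B, 2 ≤ (rowNb w A y).card) : 2 ≤ satCount w A B := by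
  induction hn : A.card using Nat.strong_induction_on generalizing A B with
  | _ n ih =>
  by_cases ht : ∃ S ⊆ A, S.Nonempty ∧ S ≠ A ∧ (nb w B S).card = S.card
  · obtain ⟨S, hS, hne, hSA, ht⟩ := ht
    have hss : S ⊂ A := lt_of_le_of_ne hS hSA
    have hlt := Finset.card_lt_card hss
    have h1 := Finset.card_sdiff_add_card_eq_card hS
    have h2 := Finset.card_sdiff_add_card_eq_card (nb_subset w B S)
    have hpos := Finset.card_pos.2 hne
    have h3 := ih (A \ S).card (by omega) (h.sdiff hS (by simpa using ht)) (by omega)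
      (Finset.card_pos.1 (by omega)) (fun y hy => by
        rw [rowNb_sdiff_eq hy]; exact hleaf y (Finset.mem_sdiff.1 hy).1) rfl
    have h4 := (h.nb_self hS).satCount_pos
    have h5 := satCount_mul_le w hS (nb_subset w B S)
    nlinarith
  · push Not at ht
    obtain ⟨y, hy⟩ := hA
    obtain ⟨a, ha, b, hb, hab⟩ := Finset.one_lt_card.1 (hleaf y hy)
    rw [mem_rowNb] at ha hb
    -- Without proper tight sets every proper set of rows has a spare neighbor, which absorbs the
    -- loss of `y`. So each edge at `y` extends to a perfect matching.
    have key : ∀ x ∈ A, 0 < w x y → 1 ≤ w x y * satCount w (A.erase x) (B.erase y) := by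
      intro x hx hxy
      refine Nat.mul_pos hxy (Surplus.satCount_pos fun S hS hne => ?_)
      have hSA : S ⊆ A := hS.trans (Finset.erase_subset _ _)
      have h1 := ht S hSA hne (fun hSA => Finset.notMem_erase x A (hS (hSA ▸ hx)))
      have h2 := h S hSA hne
      have h3 := Finset.pred_card_le_card_erase (s := nb w B S) (a := y)
      rw [nb_erase]; omega
    have h1 := sum_two_le (f := fun x => w x y * satCount w (A.erase x) (B.erase y)) ha.1 hb.1 hab
    have h2 := key a ha.1 ha.2
    have h3 := key b hb.1 hb.2
    rw [satCount_col w A hy]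
    omega

/-- Every column can be avoided when the surplus is positive. -/
lemma Surplus.card_le_satCount_of_card_eq {w : α → β → ℕ} {A : Finset α} {B : Finset β}
    (h : Surplus w A B 1) (hc : B.card = A.card + 1) : B.card ≤ satCount w A B := by
  have hsum := sum_satCount_erase_eq w hc
  rw [one_mul] at hsum
  rw [← hsum, Finset.card_eq_sum_ones]
  exact Finset.sum_le_sum fun y _ => (h.erase_right y).satCount_pos

/-- With surplus one and one spare column, there are at least `e - n + 1` saturating matchings. -/
lemma Surplus.weightSum_le {w : α → β → ℕ} {A : Finset α} {B : Finset β}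
    (h : Surplus w A B 1) (hc : B.card = A.card + 1) :
    weightSum w A B + 1 ≤ satCount w A B + A.card := by
  induction hn : weightSum w A B using Nat.strong_induction_on generalizing w with
  | _ n ih =>
  by_cases hrow : ∀ x ∈ A, ∑ y ∈ B, w x y ≤ 2
  -- Here the number of edges is at most `2|A|`, and the `|A| + 1` matchings obtained by avoiding
  -- each column suffice.
  · have h1 := h.card_le_satCount_of_card_eq hc
    have h2 : weightSum w A B ≤ ∑ x ∈ A, 2 := Finset.sum_le_sum hrow
    simp only [Finset.sum_const, smul_eq_mul] at h2
    omega
  · push Not at hrow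
    obtain ⟨x, hx, hrow⟩ := hrow
    -- A row of degree at least three has a removable edge. Otherwise each of its edges is simple
    -- and is the only edge from some tight set to its column. A smallest tight set `S` containing
    -- `x` lies in all these sets, so `x` shares no neighbor with the rest of `S`. Then `S` has at
    -- least `|S| + 2` neighbors, a contradiction.
    obtain ⟨y, hyB, hy, hdec⟩ : ∃ y ∈ B, 0 < w x y ∧ Surplus (decEdge w x y) A B 1 := by
      by_contra hcon
      push Not at hcon
      have hcrit : ∀ y ∈ B, 0 < w x y → w x y ≤ 1 ∧ ∃ S ⊆ A, x ∈ S ∧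
          (nb w B S).card = S.card + 1 ∧ ∀ z ∈ S, z ≠ x → w z y = 0 := fun y hyB hy =>
        h.decEdge_or.resolve_left (hcon y hyB hy)
      have hxn : (nb w B {x}).card = ∑ y ∈ B, w x y := by
        rw [nb, Finset.card_filter]
        refine Finset.sum_congr rfl fun y hy => ?_
        by_cases hxy : 0 < w x y
        · have := (hcrit y hy hxy).1
          simp [hxy]; omega
        · simp at hxy; simp [hxy]
      have hAt : (nb w B A).card = A.card + 1 := by
        have h1 := h A subset_rfl ⟨x, hx⟩
        have h2 := Finset.card_le_card (nb_subset w B A)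
        omega
      obtain ⟨S, hS, hmin⟩ := Finset.exists_min_image
        (A.powerset.filter fun S => x ∈ S ∧ (nb w B S).card = S.card + 1) Finset.card
        ⟨A, by simp [hx, hAt]⟩
      simp only [Finset.mem_filter, Finset.mem_powerset] at hS hmin
      obtain ⟨hSA, hxS, hSt⟩ := hS
      have hpriv : Disjoint (nb w B {x}) (nb w B (S.erase x)) := by
        rw [Finset.disjoint_left]
        intro y hy hy'
        simp only [mem_nb, Finset.mem_singleton, exists_eq_left] at hy hy'
        obtain ⟨-, D, hDA, hxD, hDt, hD⟩ := hcrit y hy.1 hy.2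
        obtain ⟨-, z, hz, hzy⟩ := hy'
        have hne : (D ∩ S).Nonempty := ⟨x, Finset.mem_inter.2 ⟨hxD, hxS⟩⟩
        have h1 := hmin (D ∩ S) ⟨Finset.inter_subset_left.trans hDA,
          Finset.mem_inter.2 ⟨hxD, hxS⟩, h.tight_inter hDA hSA hne hDt hSt⟩
        have h2 : D ∩ S = S := Finset.eq_of_subset_of_card_le Finset.inter_subset_right h1
        have hzD : z ∈ D := Finset.inter_subset_left (h2.symm ▸ Finset.mem_of_mem_erase hz)
        have := hD z hzD (Finset.ne_of_mem_erase hz)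
        omega
      have h1 : S = {x} ∪ S.erase x := by
        ext z; simp only [Finset.mem_union, Finset.mem_singleton, Finset.mem_erase]
        by_cases hzx : z = x
        · subst hzx; simp [hxS]
        · simp [hzx]
      have h2 : (nb w B S).card = (nb w B {x}).card + (nb w B (S.erase x)).card := by
        conv_lhs => rw [h1, nb_union]
        exact Finset.card_union_of_disjoint hpriv
      have h3 := Finset.card_erase_add_one hxS
      rcases (S.erase x).eq_empty_or_nonempty with h0 | h0
      · rw [h0] at h3
        simp at h3
        omega
      · have := h (S.erase x) ((Finset.erase_subset _ _).trans hSA) h0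
        omega
    have h1 := weightSum_decEdge w hx hyB hy
    have h2 := ih (weightSum (decEdge w x y) A B) (by omega) hdec rfl
    have h3 := satCount_decEdge w hx hyB hy
    have h4 := ((h.erase_right y).mono_left (Finset.erase_subset x A)).satCount_pos
    omega

/-- With positive surplus and no isolated column, there are at least as many saturating
matchings as columns. -/
lemma Surplus.card_le_satCount {w : α → β → ℕ} {A : Finset α} {B : Finset β} {T : ℕ}
    (h : Surplus w A B 1) (hc : B.card = A.card + (T + 1))
    (hcov : ∀ y ∈ B, (rowNb w A y).Nonempty) : B.card ≤ satCount w A B := by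
  induction T generalizing A B with
  | zero => exact h.card_le_satCount_of_card_eq hc
  | succ T ih =>
    by_cases ht : ∃ S ⊆ A, S.Nonempty ∧ (nb w B S).card = S.card + 1
    · obtain ⟨S₀, h₀, hne₀, ht₀⟩ := ht
      obtain ⟨S, hS, hne, ht, hsur⟩ := h.exists_maximal_tight h₀ hne₀ ht₀
      have h1 := Finset.card_sdiff_add_card_eq_card hS
      have h2 := Finset.card_sdiff_add_card_eq_card (nb_subset w B S)
      have hcov' : ∀ y ∈ B \ nb w B S, (rowNb w (A \ S) y).Nonempty := fun y hy => by
        rw [rowNb_sdiff_eq hy]; exact hcov y (Finset.mem_sdiff.1 hy).1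
      have h3 := ih hsur (by omega) hcov'
      have h4 := (h.nb_self hS).card_le_satCount_of_card_eq ht
      have h5 := satCount_mul_le w hS (nb_subset w B S)
      have hpos := Finset.card_pos.2 hne
      have h6 : 0 < (A \ S).card := by
        obtain ⟨y, hy⟩ : (B \ nb w B S).Nonempty := Finset.card_pos.1 (by omega)
        obtain ⟨x, hx⟩ := hcov' y hy
        exact Finset.card_pos.2 ⟨x, (mem_rowNb.1 hx).1⟩
      have h7 := Nat.mul_le_mul h4 h3
      -- Both factors are at least two, so their product is at least their sum, which is `|B|`.
      nlinarith [Nat.mul_le_mul (show 2 ≤ (nb w B S).card by omega)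
        (show 2 ≤ (B \ nb w B S).card by omega)]
    · push Not at ht
      obtain ⟨y, hy⟩ : B.Nonempty := Finset.card_pos.1 (by omega)
      have h2 : Surplus w A B 2 := fun S hS hne => by
        have h3 := h S hS hne
        have h4 := ht S hS hne
        omega
      have h3 := Finset.card_erase_add_one hy
      have h4 := ih (h2.erase_right y) (by omega) fun z hz => hcov z (Finset.mem_of_mem_erase hz)
      obtain ⟨x, hx⟩ := hcov y hy
      rw [mem_rowNb] at hx
      have h5 := Nat.mul_pos hx.2
        ((h.erase_right y).mono_left (Finset.erase_subset x A)).satCount_pos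
      have h6 := Finset.single_le_sum
        (f := fun x => w x y * satCount w (A.erase x) (B.erase y))
        (fun _ _ => Nat.zero_le _) hx.1
      rw [satCount_col w A hy]
      omega

end Surplus

/-! ### One spare column, every column with at least two neighbors. -/

section Leafless

set_option linter.unusedSectionVars false

variable {α β : Type*} [DecidableEq α] [DecidableEq β]

/-- Every column of `B` is adjacent to at least two rows of `A`. -/
def Leafless (w : α → β → ℕ) (A : Finset α) (B : Finset β) : Prop :=
  ∀ y ∈ B, 2 ≤ (rowNb w A y).card

lemma Leafless.decEdge {w : α → β → ℕ} {A : Finset α} {B : Finset β} (h : Leafless w A B)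
    {x : α} {y : β} (hxy : 2 ≤ w x y ∨ 3 ≤ (rowNb w A y).card) :
    Leafless (decEdge w x y) A B := by
  intro z hz
  by_cases hzy : z = y
  · subst hzy
    rcases hxy with hxy | hxy
    · refine (h z hz).trans (Finset.card_le_card fun a ha => ?_)
      rw [mem_rowNb] at ha ⊢
      refine ⟨ha.1, ?_⟩
      by_cases hax : a = x
      · subst hax; rw [decEdge_self]; omega
      · rw [decEdge_of_left_ne w _ _ hax]; exact ha.2
    · have h1 : (rowNb w A z).erase x ⊆ rowNb (_root_.decEdge w x z) A z := fun a ha => by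
        rw [Finset.mem_erase, mem_rowNb] at ha
        rw [mem_rowNb, decEdge_of_left_ne w _ _ ha.1]
        exact ha.2
      have h2 := Finset.card_le_card h1
      have h3 := Finset.pred_card_le_card_erase (s := rowNb w A z) (a := x)
      omega
  · refine (h z hz).trans (Finset.card_le_card fun a ha => ?_)
    rw [mem_rowNb] at ha ⊢
    rwa [decEdge_of_right_ne w x a hzy]

lemma Leafless.sdiff {w : α → β → ℕ} {A S : Finset α} {B : Finset β} (h : Leafless w A B) :
    Leafless w (A \ S) (B \ nb w B S) := fun y hy => by
  rw [rowNb_sdiff_eq hy]; exact h y (Finset.mem_sdiff.1 hy).1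

lemma Leafless.mono_right {w : α → β → ℕ} {A : Finset α} {B B' : Finset β}
    (h : Leafless w A B) (hB : B' ⊆ B) : Leafless w A B' := fun y hy => h y (hB hy)

lemma Leafless.covered_erase {w : α → β → ℕ} {A : Finset α} {B : Finset β}
    (h : Leafless w A B) (x : α) : ∀ y ∈ B, (rowNb w (A.erase x) y).Nonempty := fun y hy => by
  obtain ⟨a, ha, b, hb, hab⟩ := Finset.one_lt_card.1 (h y hy)
  rw [mem_rowNb] at ha hb
  by_cases hax : a = x
  · exact ⟨b, mem_rowNb.2 ⟨Finset.mem_erase.2 ⟨fun hbx => hab (hax.trans hbx.symm), hb.1⟩, hb.2⟩⟩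
  · exact ⟨a, mem_rowNb.2 ⟨Finset.mem_erase.2 ⟨hax, ha.1⟩, ha.2⟩⟩

lemma sum_eq_add_add_sum_erase {ι : Type*} [DecidableEq ι] {s : Finset ι} {a b : ι} (ha : a ∈ s)
    (hb : b ∈ s) (hab : a ≠ b) (f : ι → ℕ) :
    ∑ i ∈ s, f i = f a + f b + ∑ i ∈ (s.erase a).erase b, f i := by
  rw [← Finset.add_sum_erase s f ha, ← Finset.add_sum_erase (s.erase a) f
    (Finset.mem_erase.2 ⟨hab.symm, hb⟩), add_assoc]

/-- Expansion along a row with exactly two neighbors. -/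
lemma satCount_of_two_nb {w : α → β → ℕ} {A : Finset α} {B : Finset β} {x : α} {y₁ y₂ : β}
    (hx : x ∈ A) (h₁ : y₁ ∈ B) (h₂ : y₂ ∈ B) (hne : y₁ ≠ y₂) (hw₁ : w x y₁ = 1) (hw₂ : w x y₂ = 1)
    (hw : ∀ y ∈ (B.erase y₁).erase y₂, w x y = 0) :
    satCount w A B = 2 * satCount w (A.erase x) ((B.erase y₁).erase y₂)
      + ∑ z ∈ A.erase x,
        (w z y₁ + w z y₂) * satCount w ((A.erase x).erase z) ((B.erase y₁).erase y₂) := by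
  rw [satCount_row w B hx, sum_eq_add_add_sum_erase h₁ h₂ hne,
    Finset.sum_eq_zero fun y hy => by rw [hw y hy, zero_mul], hw₁, hw₂,
    satCount_col w (A.erase x) (Finset.mem_erase.2 ⟨hne.symm, h₂⟩ : y₂ ∈ B.erase y₁),
    satCount_col w (A.erase x) (Finset.mem_erase.2 ⟨hne, h₁⟩ : y₁ ∈ B.erase y₂),
    Finset.erase_right_comm (a := y₂) (b := y₁)]
  simp only [add_mul, Finset.sum_add_distrib]
  ring

lemma weightSum_of_two_nb {w : α → β → ℕ} {A : Finset α} {B : Finset β} {x : α} {y₁ y₂ : β}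
    (hx : x ∈ A) (h₁ : y₁ ∈ B) (h₂ : y₂ ∈ B) (hne : y₁ ≠ y₂) (hw₁ : w x y₁ = 1) (hw₂ : w x y₂ = 1)
    (hw : ∀ y ∈ (B.erase y₁).erase y₂, w x y = 0) :
    weightSum w A B = 2 + ∑ z ∈ A.erase x,
      (w z y₁ + w z y₂ + ∑ y ∈ (B.erase y₁).erase y₂, w z y) := by
  rw [weightSum, ← Finset.add_sum_erase A _ hx, sum_eq_add_add_sum_erase h₁ h₂ hne,
    Finset.sum_eq_zero hw, hw₁, hw₂]
  congr 1
  exact Finset.sum_congr rfl fun z _ => sum_eq_add_add_sum_erase h₁ h₂ hne _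

/-- A row `x` whose two neighbors have just one further neighbor. -/
lemma two_mul_weightSum_le_of_pendant {w : α → β → ℕ} {A : Finset α} {B : Finset β} {x z : α}
    {y₁ y₂ : β} (h : Surplus w A B 1) (hc : B.card = A.card + 1)
    (hx : x ∈ A) (h₁ : y₁ ∈ B) (h₂ : y₂ ∈ B) (hne : y₁ ≠ y₂) (hw₁ : w x y₁ = 1) (hw₂ : w x y₂ = 1)
    (hw : ∀ y ∈ (B.erase y₁).erase y₂, w x y = 0) (hz : z ∈ A.erase x)
    (hz₁ : w z y₁ = 1) (hz₂ : w z y₂ = 1)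
    (hother : ∀ a ∈ (A.erase x).erase z, w a y₁ = 0 ∧ w a y₂ = 0) :
    2 * weightSum w A B ≤ satCount w A B + 2 * A.card + 2 := by
  have hΦ := satCount_of_two_nb hx h₁ h₂ hne hw₁ hw₂ hw
  have he := weightSum_of_two_nb hx h₁ h₂ hne hw₁ hw₂ hw
  rw [← Finset.add_sum_erase (A.erase x) _ hz, hz₁, hz₂] at hΦ he
  rw [Finset.sum_eq_zero fun a ha => by rw [(hother a ha).1, (hother a ha).2]; simp] at hΦ
  rw [Finset.sum_congr (s₁ := (A.erase x).erase z) (g := fun a => ∑ y ∈ (B.erase y₁).erase y₂, w a y)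
    rfl fun a ha => by rw [(hother a ha).1, (hother a ha).2]; simp] at he
  set C := (B.erase y₁).erase y₂ with hC
  set A'' := (A.erase x).erase z with hA''
  have hcA1 := Finset.card_erase_add_one hx
  have hcA2 := Finset.card_erase_add_one hz
  have hcB1 := Finset.card_erase_add_one h₁
  have hcB2 := Finset.card_erase_add_one (Finset.mem_erase.2 ⟨hne.symm, h₂⟩ : y₂ ∈ B.erase y₁)
  rw [← hA''] at hcA2
  rw [← hC] at hcB2
  -- Rows other than `x` and `z` do not see `y₁` or `y₂`, so their surplus is unchanged. Every edge
  -- from `z` into `C` then extends, and `Surplus.weightSum_le` counts the matchings of the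
  -- remaining rows.
  have hsur : Surplus w A'' C 1 := fun S hS hSne => by
    refine (h S (hS.trans ((Finset.erase_subset _ _).trans (Finset.erase_subset _ _))) hSne).trans
      (Finset.card_le_card fun y hy => ?_)
    obtain ⟨hyB, a, ha, hay⟩ := mem_nb.1 hy
    have h3 := hother a (hS ha)
    refine mem_nb.2 ⟨?_, a, ha, hay⟩
    rw [hC, Finset.mem_erase, Finset.mem_erase]
    refine ⟨?_, ?_, hyB⟩ <;> rintro rfl <;> omega
  have h3 := hsur.weightSum_le (by omega)
  have h4 : ∑ y ∈ C, w z y ≤ satCount w (A.erase x) C := by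
    rw [satCount_row w C hz]
    exact Finset.sum_le_sum fun y _ => Nat.le_mul_of_pos_right _ (hsur.erase_right y).satCount_pos
  unfold weightSum at h3
  omega

/-- Merging the column `y₂` into the column `y₁`. -/
def mergeCol (w : α → β → ℕ) (y₁ y₂ : β) (a : α) (b : β) : ℕ :=
  if b = y₁ then w a y₁ + w a y₂ else w a b

/-- A matching of the contracted graph that uses the merged column lifts uniquely, with `x` taking
the other of the two columns. One that avoids it lifts in two ways, whence the additional first
summand. -/
lemma satCount_mergeCol {w : α → β → ℕ} {A : Finset α} {B : Finset β} {x : α} {y₁ y₂ : β}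
    (hx : x ∈ A) (h₁ : y₁ ∈ B) (h₂ : y₂ ∈ B) (hne : y₁ ≠ y₂) (hw₁ : w x y₁ = 1) (hw₂ : w x y₂ = 1)
    (hw : ∀ y ∈ (B.erase y₁).erase y₂, w x y = 0) :
    satCount w A B = satCount w (A.erase x) ((B.erase y₁).erase y₂)
      + satCount (mergeCol w y₁ y₂) (A.erase x) (B.erase y₂) := by
  have hcong : ∀ A', satCount (mergeCol w y₁ y₂) A' ((B.erase y₂).erase y₁)
      = satCount w A' ((B.erase y₁).erase y₂) := fun A' => by
    rw [Finset.erase_right_comm]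
    refine satCount_congr fun a _ b hb => ?_
    simp only [Finset.mem_erase] at hb
    simp [mergeCol, hb.2.1]
  rw [satCount_of_two_nb hx h₁ h₂ hne hw₁ hw₂ hw, satCount_col (mergeCol w y₁ y₂) (A.erase x)
    (Finset.mem_erase.2 ⟨hne, h₁⟩ : y₁ ∈ B.erase y₂), hcong]
  simp only [hcong, mergeCol, if_true]
  ring

lemma weightSum_mergeCol {w : α → β → ℕ} {A : Finset α} {B : Finset β} {x : α} {y₁ y₂ : β}
    (hx : x ∈ A) (h₁ : y₁ ∈ B) (h₂ : y₂ ∈ B) (hne : y₁ ≠ y₂) (hw₁ : w x y₁ = 1) (hw₂ : w x y₂ = 1)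
    (hw : ∀ y ∈ (B.erase y₁).erase y₂, w x y = 0) :
    weightSum w A B = 2 + weightSum (mergeCol w y₁ y₂) (A.erase x) (B.erase y₂) := by
  rw [weightSum_of_two_nb hx h₁ h₂ hne hw₁ hw₂ hw, weightSum]
  congr 1
  refine Finset.sum_congr rfl fun z _ => ?_
  rw [← Finset.add_sum_erase (B.erase y₂) _ (Finset.mem_erase.2 ⟨hne, h₁⟩ : y₁ ∈ B.erase y₂),
    Finset.erase_right_comm]
  congr 1
  · simp [mergeCol]
  · refine Finset.sum_congr rfl fun b hb => ?_
    simp only [Finset.mem_erase] at hb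
    simp [mergeCol, hb.1]

/-- If `S` meets one of the two columns, adjoining `x` raises the guaranteed neighborhood by one,
which pays for the merging. Otherwise the merging does not affect `S`. -/
lemma Surplus.mergeCol {w : α → β → ℕ} {A : Finset α} {B : Finset β} {x : α} {y₁ y₂ : β}
    (h : Surplus w A B 1) (hx : x ∈ A) (h₁ : y₁ ∈ B) (hne : y₁ ≠ y₂)
    (hw : ∀ y ∈ (B.erase y₁).erase y₂, w x y = 0) :
    Surplus (mergeCol w y₁ y₂) (A.erase x) (B.erase y₂) 1 := by
  intro S hS hSne
  have hSA : S ⊆ A := hS.trans (Finset.erase_subset _ _)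
  have hsub : ∀ y, y ≠ y₁ → y ≠ y₂ → y ∈ nb w B (insert x S) →
      y ∈ nb (_root_.mergeCol w y₁ y₂) (B.erase y₂) S := fun y hy1 hy2 hy => by
    obtain ⟨hyB, a, ha, hay⟩ := mem_nb.1 hy
    refine mem_nb.2 ⟨Finset.mem_erase.2 ⟨hy2, hyB⟩, a, ?_, by simpa [_root_.mergeCol, hy1] using hay⟩
    rcases Finset.mem_insert.1 ha with rfl | ha
    · have := hw y (by simp [hy1, hy2, hyB]); omega
    · exact ha
  by_cases hy : ∃ a ∈ S, 0 < w a y₁ + w a y₂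
  · obtain ⟨a, ha, hay⟩ := hy
    have hy1 : y₁ ∈ nb (_root_.mergeCol w y₁ y₂) (B.erase y₂) S :=
      mem_nb.2 ⟨Finset.mem_erase.2 ⟨hne, h₁⟩, a, ha, by simpa [_root_.mergeCol] using hay⟩
    have h3 : (nb w B (insert x S)).erase y₂ ⊆ nb (_root_.mergeCol w y₁ y₂) (B.erase y₂) S := by
      intro y hy
      by_cases hyy : y = y₁
      · exact hyy ▸ hy1
      · exact hsub y hyy (Finset.ne_of_mem_erase hy) (Finset.mem_of_mem_erase hy)
    have h4 := Finset.card_le_card h3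
    have h5 := Finset.pred_card_le_card_erase (s := nb w B (insert x S)) (a := y₂)
    have h6 := h (insert x S) (Finset.insert_subset hx hSA) (Finset.insert_nonempty _ _)
    rw [Finset.card_insert_of_notMem fun hxS => Finset.notMem_erase x A (hS hxS)] at h6
    omega
  · push Not at hy
    refine (h S hSA hSne).trans (Finset.card_le_card fun y hyS => ?_)
    obtain ⟨hyB, a, ha, hay⟩ := mem_nb.1 hyS
    have := hy a ha
    refine hsub y ?_ ?_ (nb_mono w B (Finset.subset_insert x S) hyS) <;> rintro rfl <;> omega

/-- The case of one spare column of `Surplus.mul_le_satCount`. -/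
lemma Surplus.two_mul_weightSum_le {w : α → β → ℕ} {A : Finset α} {B : Finset β}
    (h : Surplus w A B 1) (hc : B.card = A.card + 1) (hleaf : Leafless w A B) :
    2 * weightSum w A B ≤ satCount w A B + 2 * A.card + 2 := by
  induction hn : weightSum w A B using Nat.strong_induction_on generalizing w A B with
  | _ n ih =>
  subst hn
  -- Removing such an edge lowers the left side by two. At least two matchings use it, because the
  -- graph without its endpoints has one spare column and no isolated column.
  by_cases hR : ∃ x ∈ A, ∃ y ∈ B, 0 < w x y ∧ Surplus (_root_.decEdge w x y) A B 1 ∧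
      Leafless (_root_.decEdge w x y) A B
  · obtain ⟨x, hx, y, hy, hxy, h1, h2⟩ := hR
    have h3 := weightSum_decEdge w hx hy hxy
    have h4 := ih _ (by omega) h1 hc h2 rfl
    have h5 := satCount_decEdge w hx hy hxy
    have hcA := Finset.card_erase_add_one hx
    have hcB := Finset.card_erase_add_one hy
    have h6 := two_le_satCount_of_covered
      ((h.erase_right y).mono_left (Finset.erase_subset x A)) (by omega)
      (fun z hz => hleaf.covered_erase x z (Finset.mem_of_mem_erase hz))
    omega
  push Not at hR
  -- A copy of a multiple edge could be removed without affecting any neighborhood.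
  have hle1 : ∀ x ∈ A, ∀ y ∈ B, w x y ≤ 1 := fun x hx y hy => by
    by_contra hcon
    refine hR x hx y hy (by omega) ?_ (hleaf.decEdge (Or.inl (by omega)))
    exact h.decEdge_or.resolve_right fun h1 => hcon h1.1
  have hcrit : ∀ x ∈ A, ∀ y ∈ B, 0 < w x y → 3 ≤ (rowNb w A y).card → ∃ S ⊆ A, x ∈ S ∧
      (nb w B S).card = S.card + 1 ∧ ∀ z ∈ S, z ≠ x → w z y = 0 := fun x hx y hy hxy hr =>
    (h.decEdge_or.resolve_left
      fun h1 => hR x hx y hy hxy h1 (hleaf.decEdge (Or.inr hr))).2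
  have hBne : B.Nonempty := Finset.card_pos.1 (by omega)
  have hAne : A.Nonempty := by
    obtain ⟨y, hy⟩ := hBne
    have := hleaf y hy
    obtain ⟨a, ha⟩ := Finset.card_pos.1 (show 0 < (rowNb w A y).card by omega)
    exact ⟨a, (mem_rowNb.1 ha).1⟩
  have hAt : (nb w B A).card = A.card + 1 := by
    have h1 := h A subset_rfl hAne
    have h2 := Finset.card_le_card (nb_subset w B A)
    omega
  obtain ⟨S, hS, hmin⟩ := Finset.exists_min_image
    (A.powerset.filter fun S => S.Nonempty ∧ (nb w B S).card = S.card + 1) Finset.card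
    ⟨A, by simp [hAne, hAt]⟩
  simp only [Finset.mem_filter, Finset.mem_powerset] at hS hmin
  obtain ⟨hSA, hSne, hSt⟩ := hS
  have hSpos := Finset.card_pos.2 hSne
  rcases Nat.lt_or_ge 1 S.card with hS2 | hS1
  · -- a smallest tight set with more than one row spans a component of type `K₂,₃`
    have hdeg : ∀ y ∈ B, ∀ a ∈ S, ∀ b ∈ S, a ≠ b → 0 < w a y → 0 < w b y →
        (rowNb w A y).card ≤ 2 := by
      intro y hy a ha b hb hab hay hby
      by_contra hcon
      obtain ⟨D, hDA, haD, hDt, hD⟩ := hcrit a (hSA ha) y hy hay (by omega)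
      have hne : (D ∩ S).Nonempty := ⟨a, Finset.mem_inter.2 ⟨haD, ha⟩⟩
      have h1 := hmin (D ∩ S) ⟨Finset.inter_subset_left.trans hDA, hne,
        h.tight_inter hDA hSA hne hDt hSt⟩
      have h2 : D ∩ S = S := Finset.eq_of_subset_of_card_le Finset.inter_subset_right h1
      have := hD b (Finset.inter_subset_left (h2.symm ▸ hb)) hab.symm
      omega
    have hSr : ∀ y ∈ B, (rowNb w S y).card ≤ 2 := by
      intro y hy
      by_contra hcon
      obtain ⟨a, ha, b, hb, hab⟩ := Finset.one_lt_card.1 (show 1 < (rowNb w S y).card by omega)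
      rw [mem_rowNb] at ha hb
      have h1 := hdeg y hy a ha.1 b hb.1 hab ha.2 hb.2
      have h2 : rowNb w S y ⊆ rowNb w A y := Finset.filter_subset_filter _ hSA
      have := Finset.card_le_card h2
      omega
    have hcol : ∀ y ∈ B, ∑ x ∈ S, w x y = (rowNb w S y).card := by
      intro y hy
      rw [rowNb, Finset.card_filter]
      refine Finset.sum_congr rfl fun x hx => ?_
      have := hle1 x (hSA hx) y hy
      split_ifs <;> omega
    have hrow : ∀ x ∈ S, 3 ≤ ∑ y ∈ nb w B S, w x y := by
      intro x hx
      have h1 : (nb w B {x}).card ≤ ∑ y ∈ nb w B S, w x y := by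
        have h2 : nb w B {x} = (nb w B S).filter fun y => 0 < w x y := by
          ext y
          simp only [mem_nb, Finset.mem_singleton, exists_eq_left, Finset.mem_filter]
          exact ⟨fun h => ⟨⟨h.1, x, hx, h.2⟩, h.2⟩, fun h => ⟨h.1.1, h.2⟩⟩
        rw [h2, Finset.card_filter]
        refine Finset.sum_le_sum fun y _ => ?_
        split_ifs <;> omega
      have hxA : {x} ⊆ A := Finset.singleton_subset_iff.2 (hSA hx)
      have h2 := h {x} hxA (Finset.singleton_nonempty x)
      rw [Finset.card_singleton] at h2
      have h3 : (nb w B {x}).card ≠ 2 := fun h3 => by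
        have := hmin {x} ⟨hxA, Finset.singleton_nonempty x, by simpa using h3⟩
        rw [Finset.card_singleton] at this
        omega
      omega
    -- Counting edges at `S` gives `3|S| ≤ 2|N(S)| = 2|S| + 2`, so `|S| = 2` and all inequalities
    -- are equalities.
    have hsum1 : S.card * 3 ≤ ∑ x ∈ S, ∑ y ∈ nb w B S, w x y := by
      rw [← smul_eq_mul, ← Finset.sum_const]; exact Finset.sum_le_sum hrow
    rw [Finset.sum_comm, Finset.sum_congr rfl fun y hy => hcol y (nb_subset w B S hy)] at hsum1
    have hsum2 : ∑ y ∈ nb w B S, (rowNb w S y).card ≤ (nb w B S).card * 2 := by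
      rw [← smul_eq_mul, ← Finset.sum_const]
      exact Finset.sum_le_sum fun y hy => hSr y (nb_subset w B S hy)
    have hS2' : S.card = 2 := by omega
    have heq2 : ∀ y ∈ nb w B S, (rowNb w S y).card = 2 := by
      by_contra hcon
      push Not at hcon
      obtain ⟨y, hy, hy2⟩ := hcon
      have : ∑ y ∈ nb w B S, (rowNb w S y).card < ∑ y ∈ nb w B S, 2 :=
        Finset.sum_lt_sum (fun y hy => hSr y (nb_subset w B S hy))
          ⟨y, hy, lt_of_le_of_ne (hSr y (nb_subset w B S hy)) hy2⟩
      rw [Finset.sum_const, smul_eq_mul] at this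
      omega
    -- The columns seen by `S` already have their only two neighbors there, so the other rows would
    -- have just `|A \ S|` columns available, violating the surplus.
    have hAS : A = S := by
      by_contra hAS
      have h1 : (A \ S).Nonempty := Finset.sdiff_nonempty.2 fun h1 => hAS (h1.antisymm hSA)
      have h2 := h (A \ S) Finset.sdiff_subset h1
      have h3 : nb w B (A \ S) ⊆ B \ nb w B S := by
        intro y hy
        refine Finset.mem_sdiff.2 ⟨nb_subset w B _ hy, fun hyS => ?_⟩
        obtain ⟨hyB, a, ha, hay⟩ := mem_nb.1 hy
        rw [Finset.mem_sdiff] at ha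
        have h4 : insert a (rowNb w S y) ⊆ rowNb w A y := by
          intro b hb
          rcases Finset.mem_insert.1 hb with rfl | hb
          · exact mem_rowNb.2 ⟨ha.1, hay⟩
          · exact mem_rowNb.2 ⟨hSA (mem_rowNb.1 hb).1, (mem_rowNb.1 hb).2⟩
        have h5 := Finset.card_le_card h4
        rw [Finset.card_insert_of_notMem fun h => ha.2 (mem_rowNb.1 h).1, heq2 y hyS] at h5
        obtain ⟨c, hc, d, hd, hcd⟩ := Finset.one_lt_card.1
          (show 1 < (rowNb w S y).card by rw [heq2 y hyS]; omega)
        rw [mem_rowNb] at hc hd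
        have := hdeg y hyB c hc.1 d hd.1 hcd hc.2 hd.2
        omega
      have h4 := Finset.card_le_card h3
      have h5 := Finset.card_sdiff_add_card_eq_card hSA
      have h6 := Finset.card_sdiff_add_card_eq_card (nb_subset w B S)
      omega
    subst hAS
    have he : weightSum w A B ≤ B.card * 2 := by
      rw [weightSum, Finset.sum_comm, Finset.sum_congr rfl hcol, ← smul_eq_mul, ← Finset.sum_const]
      exact Finset.sum_le_sum hSr
    have hΦ := sum_satCount_erase_eq w hc
    have hΦ' : B.card * 2 ≤ ∑ y ∈ B, satCount w A (B.erase y) := by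
      rw [← smul_eq_mul, ← Finset.sum_const]
      refine Finset.sum_le_sum fun y hy => ?_
      have := Finset.card_erase_add_one hy
      exact two_le_satCount_of_leafless w (h.erase_right y) (by omega)
        (Finset.card_pos.1 (by omega)) (hleaf.mono_right (Finset.erase_subset _ _))
    omega
  · obtain ⟨x, rfl⟩ := Finset.card_eq_one.1 (show S.card = 1 by omega)
    have hx : x ∈ A := Finset.singleton_subset_iff.1 hSA
    obtain ⟨y₁, y₂, hne, hnb⟩ := Finset.card_eq_two.1 (show (nb w B {x}).card = 2 by simpa using hSt)
    have hmem : ∀ y, y ∈ nb w B {x} ↔ y ∈ B ∧ 0 < w x y := fun y => by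
      simp [mem_nb]
    obtain ⟨h₁, hw₁⟩ := (hmem y₁).1 (by simp [hnb])
    obtain ⟨h₂, hw₂⟩ := (hmem y₂).1 (by simp [hnb])
    replace hw₁ : w x y₁ = 1 := by have := hle1 x hx y₁ h₁; omega
    replace hw₂ : w x y₂ = 1 := by have := hle1 x hx y₂ h₂; omega
    have hw : ∀ y ∈ (B.erase y₁).erase y₂, w x y = 0 := fun y hy => by
      simp only [Finset.mem_erase] at hy
      by_contra h0
      have := (hmem y).2 ⟨hy.2.2, by omega⟩
      simp [hnb, hy.1, hy.2.1] at this
    by_cases hp : ∃ z, ∀ a ∈ (A.erase x).erase z, w a y₁ = 0 ∧ w a y₂ = 0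
    · obtain ⟨z, hz⟩ := hp
      have hzw : ∀ y ∈ B, (∀ a ∈ (A.erase x).erase z, w a y = 0) → z ∈ A.erase x ∧ w z y = 1 := by
        intro y hy h0
        obtain ⟨a, ha⟩ := hleaf.covered_erase x y hy
        rw [mem_rowNb] at ha
        have haz : a = z := by
          by_contra haz
          have := h0 a (Finset.mem_erase.2 ⟨haz, ha.1⟩)
          omega
        subst haz
        have := hle1 a (Finset.mem_of_mem_erase ha.1) y hy
        exact ⟨ha.1, by omega⟩
      obtain ⟨hzA, hz₁⟩ := hzw y₁ h₁ fun a ha => (hz a ha).1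
      obtain ⟨-, hz₂⟩ := hzw y₂ h₂ fun a ha => (hz a ha).2
      exact two_mul_weightSum_le_of_pendant h hc hx h₁ h₂ hne hw₁ hw₂ hw hzA hz₁ hz₂ hz
    · push Not at hp
      have hmerge := weightSum_mergeCol hx h₁ h₂ hne hw₁ hw₂ hw
      have hΦ := satCount_mergeCol hx h₁ h₂ hne hw₁ hw₂ hw
      have hcA := Finset.card_erase_add_one hx
      have hcB1 := Finset.card_erase_add_one h₁
      have hcB2 := Finset.card_erase_add_one h₂
      have hcB3 := Finset.card_erase_add_one
        (Finset.mem_erase.2 ⟨hne.symm, h₂⟩ : y₂ ∈ B.erase y₁)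
      -- Taking `z = x` excludes nothing new. The second use, with `z = a`, yields a different row,
      -- so the merged column has two neighbors.
      obtain ⟨a, ha, hay⟩ := hp x
      obtain ⟨b, hb, hby⟩ := hp a
      have hleaf' : Leafless (_root_.mergeCol w y₁ y₂) (A.erase x) (B.erase y₂) := by
        intro y hy
        by_cases hyy : y = y₁
        · subst hyy
          refine Finset.one_lt_card.2 ⟨a, ?_, b, ?_, (Finset.ne_of_mem_erase hb).symm⟩
          · refine mem_rowNb.2 ⟨Finset.mem_of_mem_erase ha, ?_⟩
            simp only [_root_.mergeCol, if_true]
            by_contra h0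
            exact hay (by omega) (by omega)
          · refine mem_rowNb.2 ⟨Finset.mem_of_mem_erase hb, ?_⟩
            simp only [_root_.mergeCol, if_true]
            by_contra h0
            exact hby (by omega) (by omega)
        · refine (hleaf y (Finset.mem_of_mem_erase hy)).trans (Finset.card_le_card fun c hc => ?_)
          rw [mem_rowNb] at hc
          have hcx : c ≠ x := by
            rintro rfl
            have := hw y (by
              simp only [Finset.mem_erase] at hy ⊢; exact ⟨hy.1, hyy, hy.2⟩)
            omega
          exact mem_rowNb.2 ⟨Finset.mem_erase.2 ⟨hcx, hc.1⟩, by simpa [_root_.mergeCol, hyy] using hc.2⟩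
      have hih := ih _ (by omega) (h.mergeCol hx h₁ hne hw) (by omega) hleaf' rfl
      have hset : A \ {x} = A.erase x := Finset.sdiff_singleton_eq_erase x A
      have hset' : B \ nb w B {x} = (B.erase y₁).erase y₂ := by
        ext y; simp only [hnb, Finset.mem_sdiff, Finset.mem_erase, Finset.mem_insert,
          Finset.mem_singleton]; tauto
      have hR0 := h.sdiff hSA hSt
      have hRl := hleaf.sdiff (S := {x})
      rw [hset, hset'] at hRl
      have hRs : Surplus w (A.erase x) ((B.erase y₁).erase y₂) 0 := by rw [← hset, ← hset']; exact hR0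
      -- Contraction loses two edges and one row, so the induction hypothesis is short by exactly
      -- two. The square graph without `x`, `y₁` and `y₂` supplies them.
      have h2 := two_le_satCount_of_leafless w hRs (by omega) (by
        have := Finset.card_pos.2 ⟨a, Finset.mem_of_mem_erase ha⟩
        exact Finset.card_pos.1 (by omega)) hRl
      omega

end Leafless

/-! ### Induction on the number of spare columns. -/

section SpareColumns

set_option linter.unusedSectionVars false

variable {α β : Type*} [DecidableEq α] [DecidableEq β]

lemma card_rowNb_le_sum (w : α → β → ℕ) (A : Finset α) (y : β) :
    (rowNb w A y).card ≤ ∑ x ∈ A, w x y := by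
  rw [rowNb, Finset.card_filter]
  refine Finset.sum_le_sum fun x _ => ?_
  split_ifs <;> omega

lemma card_nb_singleton_le_sum (w : α → β → ℕ) (B : Finset β) (x : α) :
    (nb w B {x}).card ≤ ∑ y ∈ B, w x y := by
  rw [nb, Finset.card_filter]
  refine Finset.sum_le_sum fun y _ => ?_
  simp only [Finset.mem_singleton, exists_eq_left]
  split_ifs <;> omega

lemma Leafless.two_mul_card_le {w : α → β → ℕ} {A : Finset α} {B : Finset β}
    (h : Leafless w A B) : 2 * B.card ≤ weightSum w A B := by
  rw [weightSum, Finset.sum_comm, mul_comm, ← smul_eq_mul, ← Finset.sum_const]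
  exact Finset.sum_le_sum fun y hy => (h y hy).trans (card_rowNb_le_sum w A y)

lemma Leafless.two_le_card {w : α → β → ℕ} {A : Finset α} {B : Finset β}
    (h : Leafless w A B) (hB : B.Nonempty) : 2 ≤ A.card := by
  obtain ⟨y, hy⟩ := hB
  exact (h y hy).trans (Finset.card_le_card (Finset.filter_subset _ _))

lemma Surplus.two_mul_card_le {w : α → β → ℕ} {A : Finset α} {B : Finset β}
    (h : Surplus w A B 1) : 2 * A.card ≤ weightSum w A B := by
  rw [weightSum, mul_comm, ← smul_eq_mul, ← Finset.sum_const]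
  refine Finset.sum_le_sum fun x hx => le_trans ?_ (card_nb_singleton_le_sum w B x)
  simpa using h {x} (Finset.singleton_subset_iff.2 hx) (Finset.singleton_nonempty x)

lemma weightSum_erase_right (w : α → β → ℕ) (A : Finset α) {B : Finset β} {y : β} (hy : y ∈ B) :
    weightSum w A (B.erase y) + ∑ x ∈ A, w x y = weightSum w A B := by
  simp only [weightSum]
  rw [← Finset.sum_add_distrib]
  exact Finset.sum_congr rfl fun x _ => Finset.sum_erase_add B _ hy

/-- The edges outside a set `S` of rows and its neighborhood. -/
lemma weightSum_split (w : α → β → ℕ) {A S : Finset α} (B : Finset β) (hS : S ⊆ A) :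
    weightSum w A B = weightSum w S (nb w B S) + weightSum w (A \ S) (nb w B S)
      + weightSum w (A \ S) (B \ nb w B S) := by
  have h1 : weightSum w A B = weightSum w (A \ S) B + weightSum w S B := by
    unfold weightSum; rw [Finset.sum_sdiff hS]
  have h2 : ∀ A', weightSum w A' B
      = weightSum w A' (B \ nb w B S) + weightSum w A' (nb w B S) := fun A' => by
    unfold weightSum
    rw [← Finset.sum_add_distrib]
    exact Finset.sum_congr rfl fun x _ => (Finset.sum_sdiff (nb_subset w B S)).symm
  have h3 : weightSum w S (B \ nb w B S) = 0 :=
    Finset.sum_eq_zero fun x hx => Finset.sum_eq_zero fun y hy => by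
      rw [Finset.mem_sdiff, mem_nb] at hy
      by_contra h0
      exact hy.2 ⟨hy.1, x, hx, Nat.pos_of_ne_zero h0⟩
  rw [h1, h2 (A \ S), h2 S, h3]
  ring

/-- Counting through a set `S` of surplus one. -/
lemma Surplus.satCount_split_le {w : α → β → ℕ} {A S : Finset α} {B : Finset β} {T : ℕ}
    (h : Surplus w A B 1) (hc : B.card = A.card + (T + 2)) (hleaf : Leafless w A B)
    (hS : S ⊆ A) (ht : (nb w B S).card = S.card + 1)
    (hsur : Surplus w (A \ S) (B \ nb w B S) 1) :
    satCount w S (nb w B S) * satCount w (A \ S) (B \ nb w B S)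
      + weightSum w (A \ S) (nb w B S) * (B \ nb w B S).card ≤ satCount w A B := by
  have hcA := Finset.card_sdiff_add_card_eq_card hS
  have hcB := Finset.card_sdiff_add_card_eq_card (nb_subset w B S)
  have hleaf' := hleaf.sdiff (S := S)
  have h1 := sum_satCount_mul_le w hS (nb_subset w B S) ht
  have h2 := sum_satCount_erase_eq w ht
  rw [one_mul] at h2
  -- Once a row outside `S` takes a column of `nb w B S`, the remaining rows still have positive
  -- surplus and no isolated column, hence at least one matching per column.
  have hD : ∀ x ∈ A \ S, (B \ nb w B S).card
      ≤ satCount w ((A \ S).erase x) (B \ nb w B S) := fun x hx => by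
    have := Finset.card_erase_add_one hx
    exact (hsur.mono_left (Finset.erase_subset _ _)).card_le_satCount (T := T + 1) (by omega)
      (hleaf'.covered_erase x)
  refine le_trans ?_ h1
  rw [← h2, weightSum, Finset.sum_comm, Finset.sum_mul, Finset.sum_mul, ← Finset.sum_add_distrib]
  refine Finset.sum_le_sum fun y hy => ?_
  have hyn : y ∉ B \ nb w B S := fun h => (Finset.mem_sdiff.1 h).2 hy
  rw [satCount_col w (A \ S) (Finset.mem_insert_self y _), Finset.erase_insert hyn, mul_add]
  refine Nat.add_le_add_left ?_ _
  have hpos : 0 < satCount w S ((nb w B S).erase y) :=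
    ((h.nb_self hS).erase_right y).satCount_pos
  refine le_trans ?_ (Nat.le_mul_of_pos_left _ hpos)
  rw [Finset.sum_mul]
  exact Finset.sum_le_sum fun x hx => Nat.mul_le_mul_left _ (hD x hx)

/-- Here `a` is the size of the tight set, `m + 1` the number of remaining rows, `m + T + 2` the
number of remaining columns, `e₁` and `C` the inner and crossing edges, and `P` and `Q` the two
counts. Since `Q ≥ m + T + 2`, an inner edge is worth at least as much as a crossing one, so the
extreme case is `e₁ = 2a`. -/
lemma spare_arith_tight {a m T b β C e₁ P Q Φ : ℤ} (ha : 1 ≤ a) (hm : 1 ≤ m) (hT : 0 ≤ T)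
    (hb : 0 ≤ b) (hβ : 0 ≤ β) (he : 2 * a ≤ e₁) (hC : e₁ + C = 2 * (a + 1) + β)
    (hP : e₁ - a + 1 ≤ P) (hQ : (m * (T + 1) + 2 + b) * (T + 2) ≤ Q)
    (hΦ : P * Q + C * (m + T + 2) ≤ Φ) :
    ((m + a) * (T + 2) + 2 + (b + β)) * (T + 3) ≤ Φ := by
  have hmT : 0 ≤ m * T := by positivity
  have hmT2 : 0 ≤ m * T * T := by positivity
  have hbT : 0 ≤ b * T := by positivity
  have hQD : m + T + 2 ≤ Q := by nlinarith
  have h1 : (e₁ - a + 1) * Q ≤ P * Q := mul_le_mul_of_nonneg_right hP (by linarith)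
  have h2 : 0 ≤ (e₁ - 2 * a) * (Q - (m + T + 2)) := mul_nonneg (by linarith) (by linarith)
  have h3 : (a + 1) * Q + (2 + β) * (m + T + 2) ≤ Φ := by
    have hC' : C = 2 * (a + 1) + β - e₁ := by linarith
    subst hC'
    nlinarith
  have h4 : (a + 1) * ((m * (T + 1) + 2 + b) * (T + 2)) ≤ (a + 1) * Q :=
    mul_le_mul_of_nonneg_left hQ (by linarith)
  have h5 : 0 ≤ β * (m - 1) := mul_nonneg hβ (by linarith)
  have h6 : 0 ≤ (a - 1) * (b * (T + 2)) := mul_nonneg (by linarith) (by positivity)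
  have h7 : 0 ≤ (m - 1) * ((T + 1) * (a * (T + 2) - 2)) := by
    refine mul_nonneg (by linarith) (mul_nonneg (by linarith) ?_)
    nlinarith
  nlinarith

lemma spare_arith_avg {m T b N K e Φ : ℤ} (hm : 1 ≤ m) (hT : 0 ≤ T) (hb : 0 ≤ b)
    (hN : N = m + T + 3) (he : e = 2 * N + b)
    (hK : K = m * (T + 1) + 2 + (e - 2 * (N - 1)))
    (hΦ : N * K - e ≤ Φ) : (m * (T + 2) + 2 + b) * (T + 3) ≤ Φ := by
  subst hK he hN
  have h1 : 0 ≤ m * ((m - 1) * (T + 1)) := by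
    refine mul_nonneg (by linarith) (mul_nonneg (by linarith) (by linarith))
  have h2 : 0 ≤ (m - 1) * b := mul_nonneg (by linarith) hb
  nlinarith

/-- If every set of rows has positive surplus, every column has at least two neighbors, and
there are `T + 1` more columns than rows, then the number of saturating matchings is bounded
below in terms of the number of edges. -/
theorem Surplus.mul_le_satCount {w : α → β → ℕ} {A : Finset α} {B : Finset β} {T : ℕ}
    (h : Surplus w A B 1) (hc : B.card = A.card + (T + 1)) (hleaf : Leafless w A B) :
    (((A.card : ℤ) - 1) * (T + 1) + 2 + ((weightSum w A B : ℤ) - 2 * B.card)) * (T + 2)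
      ≤ satCount w A B := by
  induction T generalizing A B with
  | zero =>
    have h1 := h.two_mul_weightSum_le hc hleaf
    push_cast
    zify at h1 hc
    rw [hc]
    push_cast
    linarith
  | succ T ih =>
    have hA2 := hleaf.two_le_card (Finset.card_pos.1 (by omega))
    have hb := hleaf.two_mul_card_le
    by_cases ht : ∃ S ⊆ A, S.Nonempty ∧ (nb w B S).card = S.card + 1
    · obtain ⟨S₀, h₀, hne₀, ht₀⟩ := ht
      obtain ⟨S, hS, hne, ht, hsur⟩ := h.exists_maximal_tight h₀ hne₀ ht₀
      have hpos := Finset.card_pos.2 hne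
      have hcA := Finset.card_sdiff_add_card_eq_card hS
      have hcB := Finset.card_sdiff_add_card_eq_card (nb_subset w B S)
      have hleaf' := hleaf.sdiff (S := S)
      have h1 := ih hsur (by omega) hleaf'
      have hb' := hleaf'.two_mul_card_le
      have hX2 := hleaf'.two_le_card (Finset.card_pos.1 (by omega))
      have h2 := h.satCount_split_le (T := T) (by omega) hleaf hS ht hsur
      have h3 := weightSum_split w B hS
      have h4 := (h.nb_self hS).weightSum_le ht
      have h5 := (h.nb_self hS).two_mul_card_le
      have h6 : 2 * (S.card + 1) ≤ weightSum w S (nb w B S) + weightSum w (A \ S) (nb w B S) := by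
        have h7 : weightSum w S (nb w B S) + weightSum w (A \ S) (nb w B S)
            = weightSum w A (nb w B S) := by
          unfold weightSum; rw [add_comm, Finset.sum_sdiff hS]
        rw [h7, ← ht]
        exact (hleaf.mono_right (nb_subset w B S)).two_mul_card_le
      zify at h2 h3 h4 h5 h6 hb hb' hA2 hX2 hcA hcB hc ht hpos
      have key := spare_arith_tight (a := S.card) (m := (A \ S).card - 1) (T := T)
        (b := weightSum w (A \ S) (B \ nb w B S) - 2 * (B \ nb w B S).card)
        (β := weightSum w S (nb w B S) + weightSum w (A \ S) (nb w B S) - 2 * (S.card + 1))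
        (C := weightSum w (A \ S) (nb w B S)) (e₁ := weightSum w S (nb w B S))
        (P := satCount w S (nb w B S)) (Q := satCount w (A \ S) (B \ nb w B S))
        (Φ := satCount w A B) (by linarith) (by linarith) (by positivity) (by linarith)
        (by linarith) h5 (by ring) (by linarith) h1 (by
          have : ((A \ S).card : ℤ) - 1 + T + 2 = (B \ nb w B S).card := by linarith
          rw [this]; exact h2)
      refine le_trans (le_of_eq ?_) key
      have e1 : (A.card : ℤ) - 1 = (A \ S).card - 1 + S.card := by linarith
      have e2 : (B.card : ℤ) = (B \ nb w B S).card + (S.card + 1) := by linarith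
      rw [e1, e2, h3]
      push_cast
      ring
    · push Not at ht
      have h2 : Surplus w A B 2 := fun S hS hne => by
        have h3 := h S hS hne
        have h4 := ht S hS hne
        omega
      -- Each matching avoids exactly `T + 2` columns. This factor cancels the last factor of the
      -- induction hypothesis summed over all deleted columns.
      have hsum := sum_satCount_erase_eq w hc
      have hstep : ∀ y ∈ B, ((((A.card : ℤ) - 1) * (T + 1) + 2 + ((weightSum w A B : ℤ)
          - 2 * (B.card - 1))) - ((∑ x ∈ A, w x y : ℕ) : ℤ)) * (T + 2)
          ≤ (satCount w A (B.erase y) : ℤ) := fun y hy => by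
        have hcB := Finset.card_erase_add_one hy
        have h3 := ih (h2.erase_right y) (by omega) (hleaf.mono_right (Finset.erase_subset _ _))
        refine le_trans (le_of_eq ?_) h3
        have h4 := weightSum_erase_right w A hy
        rw [← h4, ← hcB]
        push_cast
        ring
      have hsum' := Finset.sum_le_sum hstep
      have hw : ∑ y ∈ B, ((∑ x ∈ A, w x y : ℕ) : ℤ) = weightSum w A B := by
        rw [← Nat.cast_sum, Finset.sum_comm, weightSum]
      rw [← Finset.sum_mul, Finset.sum_sub_distrib, Finset.sum_const, nsmul_eq_mul,
        hw, ← Nat.cast_sum, hsum] at hsum'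
      push_cast at hsum'
      have hfin := le_of_mul_le_mul_right (hsum'.trans (le_of_eq (by ring :
        ((T : ℤ) + 1 + 1) * satCount w A B = satCount w A B * (T + 2)))) (by positivity)
      zify at hb hA2 hc
      have key := spare_arith_avg (m := A.card - 1) (T := T) (b := weightSum w A B - 2 * B.card)
        (by linarith) (by positivity) (by linarith) (by linarith) (by ring) rfl hfin
      refine le_trans (le_of_eq ?_) key
      push_cast
      ring

end SpareColumns

/-! ### Marshall Hall's bound with multiplicities and deficiency. -/

section ColumnDegrees

set_option linter.unusedSectionVars false

variable {α β : Type*} [DecidableEq α] [DecidableEq β]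

/-- The rows of `A` adjacent to some column of `T`. -/
def colNb (w : α → β → ℕ) (A : Finset α) (T : Finset β) : Finset α :=
  A.filter fun x => ∃ y ∈ T, 0 < w x y

/-- Every set `T` of columns of `B` has at least `|T| - p` neighbors in `A`. -/
def ColHall (w : α → β → ℕ) (A : Finset α) (B : Finset β) (p : ℕ) : Prop :=
  ∀ T ⊆ B, T.card ≤ (colNb w A T).card + p

/-- Hall's condition for columns is strict on nonempty proper subsets of `B`. -/
def ColElementary (w : α → β → ℕ) (A : Finset α) (B : Finset β) : Prop :=
  ∀ T ⊆ B, T.Nonempty → T ≠ B → T.card + 1 ≤ (colNb w A T).card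

lemma mem_colNb {w : α → β → ℕ} {A : Finset α} {T : Finset β} {x : α} :
    x ∈ colNb w A T ↔ x ∈ A ∧ ∃ y ∈ T, 0 < w x y := Finset.mem_filter

lemma colNb_subset (w : α → β → ℕ) (A : Finset α) (T : Finset β) : colNb w A T ⊆ A :=
  Finset.filter_subset _ _

lemma rowNb_subset_colNb (w : α → β → ℕ) (A : Finset α) {T : Finset β} {y : β} (hy : y ∈ T) :
    rowNb w A y ⊆ colNb w A T := fun x hx => by
  rw [mem_rowNb] at hx
  exact mem_colNb.2 ⟨hx.1, y, hy, hx.2⟩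

lemma colNb_erase_left (w : α → β → ℕ) (A : Finset α) (T : Finset β) (x : α) :
    colNb w (A.erase x) T = (colNb w A T).erase x := by
  ext z
  simp only [mem_colNb, Finset.mem_erase]; tauto

lemma colNb_colNb (w : α → β → ℕ) (A : Finset α) {T U : Finset β} (hU : U ⊆ T) :
    colNb w (colNb w A T) U = colNb w A U := by
  ext x
  simp only [mem_colNb]
  exact ⟨fun h => ⟨h.1.1, h.2⟩, fun h => ⟨⟨h.1, h.2.imp fun y hy => ⟨hU hy.1, hy.2⟩⟩, h.2⟩⟩

lemma rowNb_colNb (w : α → β → ℕ) (A : Finset α) {T : Finset β} {y : β} (hy : y ∈ T) :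
    rowNb w (colNb w A T) y = rowNb w A y := by
  ext x
  simp only [mem_rowNb, mem_colNb]
  exact ⟨fun h => ⟨h.1.1, h.2⟩, fun h => ⟨⟨h.1, y, hy, h.2⟩, h.2⟩⟩

lemma sum_colNb (w : α → β → ℕ) (A : Finset α) {T : Finset β} {y : β} (hy : y ∈ T) :
    ∑ x ∈ colNb w A T, w x y = ∑ x ∈ A, w x y :=
  Finset.sum_subset (colNb_subset w A T) fun x hx hxT => by
    by_contra h0
    exact hxT (mem_colNb.2 ⟨hx, y, hy, Nat.pos_of_ne_zero h0⟩)

lemma ColHall.colNb {w : α → β → ℕ} {A : Finset α} {B T : Finset β} {p : ℕ}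
    (h : ColHall w A B p) (hT : T ⊆ B) : ColHall w (colNb w A T) T p := fun U hU => by
  rw [colNb_colNb w A hU]; exact h U (hU.trans hT)

/-- Hall's condition for columns implies that the rows can be saturated. -/
lemma ColHall.surplus {w : α → β → ℕ} {A : Finset α} {B : Finset β} {p : ℕ}
    (h : ColHall w A B p) (hc : B.card = A.card + p) : Surplus w A B 0 := fun D hD _ => by
  have h1 := h (B \ nb w B D) Finset.sdiff_subset
  have h2 : _root_.colNb w A (B \ nb w B D) ⊆ A \ D := fun x hx => by
    obtain ⟨hxA, y, hy, hxy⟩ := mem_colNb.1 hx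
    rw [Finset.mem_sdiff, mem_nb] at hy
    exact Finset.mem_sdiff.2 ⟨hxA, fun hxD => hy.2 ⟨hy.1, x, hxD, hxy⟩⟩
  have h3 := Finset.card_le_card h2
  have h4 := Finset.card_sdiff_add_card_eq_card hD
  have h5 := Finset.card_sdiff_add_card_eq_card (nb_subset w B D)
  omega

/-- Since `T` is tight, the part outside it satisfies Hall's condition without deficiency, so every
matching on `T` extends. -/
lemma ColHall.satCount_colNb_le {w : α → β → ℕ} {A : Finset α} {B T : Finset β} {p : ℕ}
    (h : ColHall w A B p) (hc : B.card = A.card + p) (hT : T ⊆ B)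
    (ht : T.card = (_root_.colNb w A T).card + p) :
    satCount w (_root_.colNb w A T) T ≤ satCount w A B := by
  have hA := colNb_subset w A T
  have h1 := Finset.card_sdiff_add_card_eq_card hA
  have h2 := Finset.card_sdiff_add_card_eq_card hT
  have h3 : ColHall w (A \ _root_.colNb w A T) (B \ T) 0 := fun U hU => by
    have h4 := h (T ∪ U) (Finset.union_subset hT (hU.trans Finset.sdiff_subset))
    have h5 : (T ∪ U).card = T.card + U.card :=
      Finset.card_union_of_disjoint (Finset.disjoint_of_subset_right hU Finset.disjoint_sdiff)
    have h6 : _root_.colNb w A (T ∪ U)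
        ⊆ _root_.colNb w A T ∪ _root_.colNb w (A \ _root_.colNb w A T) U := fun x hx => by
      obtain ⟨hxA, y, hy, hxy⟩ := mem_colNb.1 hx
      rw [Finset.mem_union]
      by_cases hxT : x ∈ _root_.colNb w A T
      · exact Or.inl hxT
      · refine Or.inr (mem_colNb.2 ⟨Finset.mem_sdiff.2 ⟨hxA, hxT⟩, y, ?_, hxy⟩)
        exact (Finset.mem_union.1 hy).resolve_left fun hyT => hxT (mem_colNb.2 ⟨hxA, y, hyT, hxy⟩)
    have h7 := (Finset.card_le_card h6).trans (Finset.card_union_le _ _)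
    omega
  have h8 := (h3.surplus (by omega)).satCount_pos
  exact (Nat.le_mul_of_pos_right _ h8).trans (satCount_mul_le w hA hT)

/-- Strictness in Hall's condition pays for the lost row, so every edge lies in a perfect matching.
-/
lemma ColElementary.erase {w : α → β → ℕ} {A : Finset α} {B : Finset β}
    (h : ColElementary w A B) (x : α) {y : β} (hy : y ∈ B) :
    ColHall w (A.erase x) (B.erase y) 0 := fun T hT => by
  rcases T.eq_empty_or_nonempty with rfl | hne
  · simp
  have h1 := h T (hT.trans (Finset.erase_subset _ _)) hne
    fun hTB => Finset.notMem_erase y B (hT (hTB ▸ hy))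
  have h2 := Finset.pred_card_le_card_erase (s := colNb w A T) (a := x)
  rw [colNb_erase_left]
  omega

lemma card_rowNb_erase (w : α → β → ℕ) (A : Finset α) (x : α) (y : β) :
    (rowNb w A y).card ≤ (rowNb w (A.erase x) y).card + 1 := by
  have h1 : (rowNb w A y).erase x ⊆ rowNb w (A.erase x) y := fun z hz => by
    rw [Finset.mem_erase, mem_rowNb] at hz
    exact mem_rowNb.2 ⟨Finset.mem_erase.2 ⟨hz.1, hz.2.1⟩, hz.2.2⟩
  have h2 := Finset.card_le_card h1
  have h3 := Finset.pred_card_le_card_erase (s := rowNb w A y) (a := x)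
  omega

lemma ColHall.elementary_or {w : α → β → ℕ} {A : Finset α} {B : Finset β}
    (h : ColHall w A B 0) : ColElementary w A B ∨
      ∃ T ⊂ B, T.Nonempty ∧ T.card = (_root_.colNb w A T).card := by
  by_contra hcon
  push Not at hcon
  refine hcon.1 fun T hT hne hTB => ?_
  have h1 := h T hT
  have h2 := hcon.2 T (lt_of_le_of_ne hT hTB) hne
  omega

/-- Marshall Hall's bound for perfect matchings. -/
lemma ColHall.factorial_le {w : α → β → ℕ} {A : Finset α} {B : Finset β} {r : ℕ}
    (h : ColHall w A B 0) (hc : B.card = A.card) (hB : B.Nonempty)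
    (hr : ∀ y ∈ B, r ≤ (rowNb w A y).card) : r.factorial ≤ satCount w A B := by
  induction hn : B.card using Nat.strong_induction_on generalizing A B r with
  | _ n ih =>
  rcases h.elementary_or with hel | ⟨T, hT, hne, ht⟩
  · obtain ⟨y, hy⟩ := hB
    rcases r with _ | r
    · exact (h.surplus hc).satCount_pos
    have h1 : ∀ x ∈ rowNb w A y,
        r.factorial ≤ w x y * satCount w (A.erase x) (B.erase y) := fun x hx => by
      rw [mem_rowNb] at hx
      refine le_trans ?_ (Nat.le_mul_of_pos_left _ hx.2)
      have hcA := Finset.card_erase_add_one hx.1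
      have hcB := Finset.card_erase_add_one hy
      rcases (B.erase y).eq_empty_or_nonempty with h0 | h0
      · have h2 := (hr y hy).trans (Finset.card_le_card (Finset.filter_subset _ _))
        have h3 : (B.erase y).card = 0 := by simp [h0]
        obtain rfl : r = 0 := by omega
        exact ((hel.erase x hy).surplus (by omega)).satCount_pos
      · refine ih (B.erase y).card (by omega) (hel.erase x hy) (by omega) h0 (fun z hz => ?_) rfl
        have h2 := hr z (Finset.mem_of_mem_erase hz)
        have h3 := card_rowNb_erase w A x z
        omega
    rw [satCount_col w A hy, Nat.factorial_succ]
    calc (r + 1) * r.factorial ≤ (rowNb w A y).card * r.factorial :=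
          Nat.mul_le_mul_right _ (hr y hy)
      _ = ∑ x ∈ rowNb w A y, r.factorial := by rw [Finset.sum_const, smul_eq_mul]
      _ ≤ ∑ x ∈ rowNb w A y, w x y * satCount w (A.erase x) (B.erase y) := Finset.sum_le_sum h1
      _ ≤ ∑ x ∈ A, w x y * satCount w (A.erase x) (B.erase y) :=
          Finset.sum_le_sum_of_subset (Finset.filter_subset _ _)
      _ ≤ _ := Nat.le_add_left _ _
  · have hlt := Finset.card_lt_card hT
    refine (ih T.card (by omega) (h.colNb hT.subset) ht hne (fun y hy => ?_) rfl).trans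
      (h.satCount_colNb_le hc hT.subset ht)
    rw [rowNb_colNb w A hy]
    exact hr y (hT.subset hy)

lemma ColElementary.factorial_le_erase {w : α → β → ℕ} {A : Finset α} {B : Finset β} {r : ℕ}
    (h : ColElementary w A B) (hc : B.card = A.card)
    (hr : ∀ y ∈ B, r + 1 ≤ (rowNb w A y).card) {x : α} {y : β} (hx : x ∈ A) (hy : y ∈ B) :
    r.factorial ≤ satCount w (A.erase x) (B.erase y) := by
  have hcA := Finset.card_erase_add_one hx
  have hcB := Finset.card_erase_add_one hy
  rcases (B.erase y).eq_empty_or_nonempty with h0 | h0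
  · have h2 := (hr y hy).trans (Finset.card_le_card (Finset.filter_subset _ _))
    have h3 : (B.erase y).card = 0 := by simp [h0]
    obtain rfl : r = 0 := by omega
    exact ((h.erase x hy).surplus (by omega)).satCount_pos
  · refine (h.erase x hy).factorial_le (by omega) h0 fun z hz => ?_
    have h2 := hr z (Finset.mem_of_mem_erase hz)
    have h3 := card_rowNb_erase w A x z
    omega

/-- Multiple edges in the elementary case. -/
lemma ColElementary.factorial_add_le {w : α → β → ℕ} {A : Finset α} {B : Finset β} {r m : ℕ}
    (h : ColElementary w A B) (h0 : ColHall w A B 0) (hc : B.card = A.card) (hB : B.Nonempty)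
    (hr : ∀ y ∈ B, r + 1 ≤ (rowNb w A y).card)
    (hm : weightSum w A B = ∑ y ∈ B, (rowNb w A y).card + m) :
    (r + 1).factorial + m * r.factorial ≤ satCount w A B := by
  induction m generalizing w with
  | zero => simpa using h0.factorial_le hc hB hr
  | succ m ih =>
    obtain ⟨x, hx, y, hy, hxy⟩ : ∃ x ∈ A, ∃ y ∈ B, 2 ≤ w x y := by
      by_contra hcon
      push Not at hcon
      have h1 : weightSum w A B = ∑ y ∈ B, (rowNb w A y).card := by
        rw [weightSum, Finset.sum_comm]
        refine Finset.sum_congr rfl fun y hy => ?_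
        rw [rowNb, Finset.card_filter]
        refine Finset.sum_congr rfl fun x hx => ?_
        have := hcon x hx y hy
        split_ifs <;> omega
      omega
    have hpos : ∀ a b, 0 < decEdge w x y a b ↔ 0 < w a b := fun a b => by
      unfold decEdge
      split_ifs with h2
      · obtain ⟨rfl, rfl⟩ := h2; omega
      · rfl
    have hrow : ∀ b, rowNb (decEdge w x y) A b = rowNb w A b := fun b => by
      simp only [rowNb, hpos]
    have hcol : ∀ T, colNb (decEdge w x y) A T = colNb w A T := fun T => by
      simp only [colNb, hpos]
    have h1 := weightSum_decEdge w hx hy (by omega)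
    have h2 := ih (w := decEdge w x y)
      (fun T hT hne hTB => by rw [hcol]; exact h T hT hne hTB)
      (fun T hT => by rw [hcol]; exact h0 T hT)
      (fun b hb => by rw [hrow]; exact hr b hb)
      (by simp only [hrow]; omega)
    have h3 := satCount_decEdge w hx hy (by omega)
    have h4 := h.factorial_le_erase hc hr hx hy
    rw [add_mul, one_mul]
    omega

/-- In column `y`, moving the whole weight of row `a` to row `b`. -/
def moveWeight (w : α → β → ℕ) (a b : α) (y : β) (x : α) (z : β) : ℕ :=
  if z = y then (if x = a then 0 else if x = b then w a y + w b y else w x y) else w x z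

lemma moveWeight_of_ne (w : α → β → ℕ) (a b : α) {y z : β} (h : z ≠ y) (x : α) :
    moveWeight w a b y x z = w x z := by simp [moveWeight, h]

lemma sum_moveWeight (w : α → β → ℕ) {A : Finset α} {a b : α} (ha : a ∈ A) (hb : b ∈ A)
    (hab : a ≠ b) (y : β) (f : α → ℕ) :
    ∑ x ∈ A, moveWeight w a b y x y * f x + w a y * f a = ∑ x ∈ A, w x y * f x + w a y * f b := by
  rw [sum_eq_add_add_sum_erase ha hb hab, sum_eq_add_add_sum_erase ha hb hab]
  have : ∑ x ∈ (A.erase a).erase b, moveWeight w a b y x y * f x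
      = ∑ x ∈ (A.erase a).erase b, w x y * f x := Finset.sum_congr rfl fun x hx => by
    simp only [Finset.mem_erase] at hx
    simp [moveWeight, hx.1, hx.2.1]
  rw [this]
  simp only [moveWeight, if_true, hab.symm, if_false]
  ring

/-- The count is linear in the entries of column `y`, and the weight of `a` passes to a cofactor
that is no larger. -/
lemma satCount_moveWeight_le (w : α → β → ℕ) {A : Finset α} {B : Finset β} {a b : α} {y : β}
    (ha : a ∈ A) (hb : b ∈ A) (hab : a ≠ b) (hy : y ∈ B)
    (hle : satCount w (A.erase b) (B.erase y) ≤ satCount w (A.erase a) (B.erase y)) :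
    satCount (moveWeight w a b y) A B ≤ satCount w A B := by
  have hcong : ∀ A', satCount (moveWeight w a b y) A' (B.erase y) = satCount w A' (B.erase y) :=
    fun A' => satCount_congr fun x _ z hz => moveWeight_of_ne w a b (Finset.ne_of_mem_erase hz) x
  rw [satCount_col w A hy, satCount_col (moveWeight w a b y) A hy]
  simp only [hcong]
  have h1 := sum_moveWeight w ha hb hab y fun x => satCount w (A.erase x) (B.erase y)
  have h2 := Nat.mul_le_mul_left (w a y) hle

  omega

lemma rowNb_moveWeight {w : α → β → ℕ} {A : Finset α} {a b : α} {y : β}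
    (hb : b ∈ rowNb w A y) : rowNb (moveWeight w a b y) A y = (rowNb w A y).erase a := by
  ext x
  rw [mem_rowNb] at hb
  simp only [mem_rowNb, Finset.mem_erase, moveWeight, if_true]
  by_cases hxa : x = a
  · simp [hxa]
  · by_cases hxb : x = b
    · subst hxb
      simp only [hxa, if_false, if_true, not_false_eq_true, ne_eq, true_and]
      constructor <;> rintro ⟨h1, -⟩
      · exact hb
      · exact ⟨h1, by omega⟩
    · simp [hxa, hxb]

/-- Only `a` can leave a neighborhood, and strictness covers this for proper sets of columns. For
all of `B`, `a` has a neighbor besides `y`, since otherwise `B.erase y` would see too few rows. -/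
lemma ColElementary.colHall_moveWeight {w : α → β → ℕ} {A : Finset α} {B : Finset β} {a b : α}
    {y : β} (h : ColElementary w A B) (h0 : ColHall w A B 0) (hc : B.card = A.card)
    (ha : a ∈ rowNb w A y) (hb : b ∈ rowNb w A y) (hab : a ≠ b) (hy : y ∈ B) :
    ColHall (moveWeight w a b y) A B 0 := by
  have hsub : ∀ T, (colNb w A T).erase a ⊆ colNb (moveWeight w a b y) A T := fun T x hx => by
    rw [Finset.mem_erase, mem_colNb] at hx
    obtain ⟨hxa, hxA, z, hz, hxz⟩ := hx
    refine mem_colNb.2 ⟨hxA, z, hz, ?_⟩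
    unfold moveWeight
    by_cases hzy : z = y
    · subst hzy
      by_cases hxb : x = b
      · subst hxb; simp [hxa, hxz]
      · simp [hxa, hxb, hxz]
    · simpa [hzy] using hxz
  intro T hT
  rcases T.eq_empty_or_nonempty with rfl | hne
  · simp
  have h1 := Finset.card_le_card (hsub T)
  have h2 := Finset.pred_card_le_card_erase (s := colNb w A T) (a := a)
  by_cases hTB : T = B
  · subst hTB
    obtain ⟨z, hz, hza⟩ : ∃ z ∈ T.erase y, 0 < w a z := by
      by_contra hcon
      push Not at hcon
      have hsub' : colNb w A (T.erase y) ⊆ A.erase a := fun x hx => by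
        obtain ⟨hxA, z, hz, hxz⟩ := mem_colNb.1 hx
        refine Finset.mem_erase.2 ⟨?_, hxA⟩
        rintro rfl
        have := hcon z hz
        omega
      have h3 := Finset.card_le_card hsub'
      have h4 := Finset.card_erase_add_one (mem_rowNb.1 ha).1
      have h5 := Finset.card_erase_add_one hy
      have h6 : 1 < A.card := Finset.one_lt_card.2
        ⟨a, (mem_rowNb.1 ha).1, b, (mem_rowNb.1 hb).1, hab⟩
      have h7 := h (T.erase y) (Finset.erase_subset _ _) (Finset.card_pos.1 (by omega))
        (fun h => by rw [h] at h5; omega)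
      omega
    have h3 : colNb w A T ⊆ colNb (moveWeight w a b y) A T := fun x hx => by
      by_cases hxa : x = a
      · subst hxa
        refine mem_colNb.2 ⟨(mem_rowNb.1 ha).1, z, Finset.mem_of_mem_erase hz, ?_⟩
        rwa [moveWeight_of_ne w x b (Finset.ne_of_mem_erase hz)]
      · exact hsub T (Finset.mem_erase.2 ⟨hxa, hx⟩)
    exact (h0 T hT).trans (Finset.card_le_card h3)
  · have := h T hT hne hTB
    omega

lemma ColHall.mul_factorial_le_of_square {w : α → β → ℕ} {A : Finset α} {B : Finset β} {r c : ℕ}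
    (h : ColHall w A B 0) (hc : B.card = A.card) (hB : B.Nonempty)
    (hr : ∀ y ∈ B, r + 1 ≤ (rowNb w A y).card) (hk : ∀ y ∈ B, r + (c + 1) ≤ ∑ x ∈ A, w x y) :
    (c + 1) * (r + 1).factorial ≤ satCount w A B := by
  induction hn : ∑ y ∈ B, (rowNb w A y).card using Nat.strong_induction_on
    generalizing w A B with
  | _ n ih =>
  subst hn
  rcases h.elementary_or with hel | ⟨T, hT, hne, ht⟩
  · by_cases hex : ∃ y ∈ B, r + 1 < (rowNb w A y).card
    · obtain ⟨y, hy, hry⟩ := hex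
      -- The row with the smallest cofactor receives the weight, so the count does not increase. The
      -- degree of `y` is kept while it loses one neighbor.
      obtain ⟨b, hb, hmin⟩ := Finset.exists_min_image (rowNb w A y)
        (fun x => satCount w (A.erase x) (B.erase y)) (Finset.card_pos.1 (by omega))
      obtain ⟨a, ha, hab⟩ := Finset.exists_mem_ne (show 1 < (rowNb w A y).card by omega) b
      have haA := (mem_rowNb.1 ha).1
      have hbA := (mem_rowNb.1 hb).1
      have hrow : ∀ z, z ≠ y → rowNb (moveWeight w a b y) A z = rowNb w A z := fun z hz => by
        simp only [rowNb, moveWeight_of_ne w a b hz]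
      have hrowy := rowNb_moveWeight (a := a) hb
      have hcard := Finset.card_erase_add_one ha
      refine (ih (∑ z ∈ B, (rowNb (moveWeight w a b y) A z).card) ?_
        (hel.colHall_moveWeight h hc ha hb hab hy) hc hB ?_ ?_ rfl).trans
        (satCount_moveWeight_le w haA hbA hab hy (hmin a ha))
      · refine Finset.sum_lt_sum (fun z _ => ?_) ⟨y, hy, by rw [hrowy]; omega⟩
        by_cases hzy : z = y
        · subst hzy; rw [hrowy]; omega
        · rw [hrow z hzy]
      · intro z hz
        by_cases hzy : z = y
        · subst hzy; rw [hrowy]; omega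
        · rw [hrow z hzy]; exact hr z hz
      · intro z hz
        by_cases hzy : z = y
        · subst hzy
          have h1 := sum_moveWeight w haA hbA hab z fun _ => 1
          simp only [mul_one] at h1
          have := hk z hz
          omega
        · simp only [moveWeight_of_ne w a b hzy]; exact hk z hz
    · push Not at hex
      have hsum : ∑ y ∈ B, (rowNb w A y).card + B.card * c ≤ weightSum w A B := by
        rw [weightSum, Finset.sum_comm, ← smul_eq_mul, ← Finset.sum_const,
          ← Finset.sum_add_distrib]
        refine Finset.sum_le_sum fun y hy => ?_
        have h1 := hex y hy
        have h2 := hk y hy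
        omega
      obtain ⟨m, hm⟩ := Nat.exists_eq_add_of_le ((Nat.le_add_right _ _).trans hsum)
      have h1 := hel.factorial_add_le h hc hB hr hm
      obtain ⟨y, hy⟩ := hB
      have h2 := (hr y hy).trans (Finset.card_le_card (Finset.filter_subset _ _))
      -- Each column now has exactly `r + 1` neighbors and excess multiplicity at least `c`, and
      -- there are `|B| = |A| ≥ r + 1` columns.
      have h3 : (r + 1) * c ≤ m :=
        (Nat.mul_le_mul_right c (h2.trans hc.ge)).trans (by omega)
      have h4 := Nat.mul_le_mul_right r.factorial h3
      rw [add_mul, one_mul, Nat.factorial_succ]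
      rw [Nat.factorial_succ] at h1
      have h5 : c * ((r + 1) * r.factorial) = (r + 1) * c * r.factorial := by ring
      omega
  · refine (ih _ ?_ (h.colNb hT.subset) ht hne (fun y hy => ?_) (fun y hy => ?_) rfl).trans
      (h.satCount_colNb_le hc hT.subset ht)
    · rw [Finset.sum_congr rfl fun y hy => by rw [rowNb_colNb w A hy]]
      obtain ⟨y, hy, hyT⟩ := Finset.exists_of_ssubset hT
      exact Finset.sum_lt_sum_of_subset hT.subset hy hyT ((Nat.succ_pos r).trans_le (hr y hy))
        fun _ _ _ => Nat.zero_le _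
    · rw [rowNb_colNb w A hy]; exact hr y (hT.subset hy)
    · rw [sum_colNb w A hy]; exact hk y (hT.subset hy)

/-- If every set `T` of columns has at least `|T| - p` neighbors and every column has at least
`r` neighbors and degree at least `k`, then there are at least `(k - r + 1) (r + p)! / p!`
matchings that saturate the rows. Here `r` and `k` are written as `r + 1` and `r + c + 1`. -/
theorem ColHall.mul_factorial_le {w : α → β → ℕ} {A : Finset α} {B : Finset β} {r c p : ℕ}
    (h : ColHall w A B p) (hc : B.card = A.card + p) (hB : B.Nonempty)
    (hr : ∀ y ∈ B, r + 1 ≤ (rowNb w A y).card) (hk : ∀ y ∈ B, r + (c + 1) ≤ ∑ x ∈ A, w x y) :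
    (c + 1) * (r + 1 + p).factorial ≤ satCount w A B * p.factorial := by
  induction p generalizing A B with
  | zero => simpa using h.mul_factorial_le_of_square hc hB hr hk
  | succ p ih =>
    have hBt : B.card = (_root_.colNb w A B).card + (p + 1) := by
      have h1 := h B subset_rfl
      have h2 := Finset.card_le_card (colNb_subset w A B)
      omega
    -- Minimality of the tight set `T` means that its proper subsets have deficiency at most `p`.
    -- Deleting any column of `T` thus leads to the induction hypothesis, and `|T| ≥ r + 1 + (p +
    -- 1)` yields the next factor of the factorial.
    obtain ⟨T, hT, hmin⟩ := Finset.exists_min_image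
      (B.powerset.filter fun T => T.card = (_root_.colNb w A T).card + (p + 1)) Finset.card
      ⟨B, by simp [← hBt]⟩
    simp only [Finset.mem_filter, Finset.mem_powerset] at hT hmin
    obtain ⟨hTB, ht⟩ := hT
    have hle := h.satCount_colNb_le hc hTB ht
    obtain ⟨y₀, hy₀⟩ : T.Nonempty := Finset.card_pos.1 (by omega)
    have hTr : r + 1 ≤ (_root_.colNb w A T).card :=
      (hr y₀ (hTB hy₀)).trans (Finset.card_le_card (rowNb_subset_colNb w A hy₀))
    have hsum := sum_satCount_erase_eq w ht
    have h1 : ∀ y ∈ T, (c + 1) * (r + 1 + p).factorial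
        ≤ satCount w (_root_.colNb w A T) (T.erase y) * p.factorial := fun y hy => by
      have hcT := Finset.card_erase_add_one hy
      have hsub : T.erase y ⊆ T := Finset.erase_subset _ _
      refine ih (fun U hU => ?_) (by omega) (Finset.card_pos.1 (by omega)) (fun z hz => ?_)
        fun z hz => ?_
      · rw [colNb_colNb w A (hU.trans hsub)]
        have h2 := h U (hU.trans (hsub.trans hTB))
        by_contra hcon
        have h3 := hmin U ⟨hU.trans (hsub.trans hTB), by omega⟩
        have h4 := Finset.card_le_card hU
        omega
      · rw [rowNb_colNb w A (hsub hz)]; exact hr z (hTB (hsub hz))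
      · rw [sum_colNb w A (hsub hz)]; exact hk z (hTB (hsub hz))
    have h2 := Finset.sum_le_sum h1
    rw [Finset.sum_const, smul_eq_mul, ← Finset.sum_mul, hsum] at h2
    calc (c + 1) * (r + 1 + (p + 1)).factorial
        = (r + 1 + p + 1) * ((c + 1) * (r + 1 + p).factorial) := by
          rw [← add_assoc, Nat.factorial_succ]; ring
      _ ≤ T.card * ((c + 1) * (r + 1 + p).factorial) := Nat.mul_le_mul_right _ (by omega)
      _ ≤ (p + 1) * satCount w (_root_.colNb w A T) T * p.factorial := h2
      _ = satCount w (_root_.colNb w A T) T * (p + 1).factorial := by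
          rw [Nat.factorial_succ]; ring
      _ ≤ _ := Nat.mul_le_mul_right _ hle

end ColumnDegrees

/-! ### From weights to sets of edges. -/

section EdgeCounting

open scoped Classical in
/-- The number of edges joining `a` to `b`, for edges with endpoints given by `l` and `r`. -/
noncomputable def edgeMult {α β E : Type*} [Fintype E] (l : E → α) (r : E → β) (a : α) (b : β) : ℕ :=
  (Finset.univ.filter fun e : E => l e = a ∧ r e = b).card

open scoped Classical in
/-- The matchings that saturate `A` and whose right endpoints lie in `B`. -/
noncomputable def satMatchings {α β E : Type*} [Fintype E] (l : E → α) (r : E → β)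
    (A : Finset α) (B : Finset β) : Finset (Finset E) :=
  Finset.univ.filter fun M => Set.InjOn l M ∧ Set.InjOn r M ∧ M.image l = A ∧ M.image r ⊆ B

lemma mem_satMatchings {α β E : Type*} [DecidableEq α] [DecidableEq β] [Fintype E] {l : E → α}
    {r : E → β} {A : Finset α} {B : Finset β} {M : Finset E} :
    M ∈ satMatchings l r A B ↔
      Set.InjOn l M ∧ Set.InjOn r M ∧ M.image l = A ∧ M.image r ⊆ B := by
  simp only [satMatchings, Finset.mem_filter, Finset.mem_univ, true_and]
  convert Iff.rfl

lemma edgeMult_pos {α β E : Type*} [Fintype E] {l : E → α} {r : E → β} {a : α} {b : β} :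
    0 < edgeMult l r a b ↔ ∃ e, l e = a ∧ r e = b := by
  classical
  simp [edgeMult, Finset.card_pos, Finset.filter_nonempty_iff]

lemma sum_edgeMult_mul {α β E : Type*} [DecidableEq α] [DecidableEq β] [Fintype E] (l : E → α)
    (r : E → β) (a : α) (B : Finset β) (f : β → ℕ) :
    ∑ b ∈ B, edgeMult l r a b * f b
      = ∑ e ∈ Finset.univ.filter (fun e : E => l e = a ∧ r e ∈ B), f (r e) := by
  rw [← Finset.sum_fiberwise_of_maps_to (t := B) (g := r)
    (fun e he => (Finset.mem_filter.1 he).2.2)]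
  refine Finset.sum_congr rfl fun b hb => ?_
  rw [Finset.sum_congr rfl fun e he => by rw [(Finset.mem_filter.1 he).2],
    Finset.sum_const, smul_eq_mul, edgeMult]
  congr 2
  ext e
  simp only [Finset.mem_filter, Finset.mem_univ, true_and]
  exact ⟨fun h => ⟨⟨h.1, h.2 ▸ hb⟩, h.2⟩, fun h => ⟨h.1.1, h.2⟩⟩

lemma sum_edgeMult {α β E : Type*} [DecidableEq α] [DecidableEq β] [Fintype E] (l : E → α)
    (r : E → β) (a : α) (B : Finset β) :
    ∑ b ∈ B, edgeMult l r a b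
      = (Finset.univ.filter fun e : E => l e = a ∧ r e ∈ B).card := by
  simpa using sum_edgeMult_mul l r a B fun _ => 1

lemma weightSum_edgeMult {α β E : Type*} [DecidableEq α] [DecidableEq β] [Fintype E] (l : E → α)
    (r : E → β) (A : Finset α) (B : Finset β) :
    weightSum (edgeMult l r) A B = (Finset.univ.filter fun e : E => l e ∈ A ∧ r e ∈ B).card := by
  rw [weightSum, Finset.card_eq_sum_card_fiberwise (t := A) (f := l)
    (fun e he => by simpa using (Finset.mem_filter.1 he).2.1)]
  refine Finset.sum_congr rfl fun a ha => ?_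
  rw [sum_edgeMult]
  congr 1
  ext e
  simp only [Finset.mem_filter, Finset.mem_univ, true_and]
  exact ⟨fun h => ⟨⟨h.1 ▸ ha, h.2⟩, h.1⟩, fun h => ⟨h.2, h.1.2⟩⟩

lemma edgeMult_swap {α β E : Type*} [Fintype E] (l : E → α) (r : E → β) (a : α) (b : β) :
    edgeMult r l b a = edgeMult l r a b := by
  classical
  simp only [edgeMult, and_comm]

lemma satCount_edgeMult_le {α β E : Type*} [DecidableEq α] [DecidableEq β] [Fintype E] (l : E → α)
    (r : E → β) (A : Finset α) (B : Finset β) :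
    satCount (edgeMult l r) A B ≤ (satMatchings l r A B).card := by
  classical
  induction A using Finset.induction generalizing B with
  | empty =>
    rw [satCount_empty]
    exact Finset.card_pos.2 ⟨∅, mem_satMatchings.2 (by simp)⟩
  | insert x A hx ih =>
    rw [satCount_insert _ B hx, sum_edgeMult_mul l r x B fun y => satCount (edgeMult l r) A (B.erase y)]
    refine (Finset.sum_le_sum fun e _ => ih (B.erase (r e))).trans ?_
    rw [← Finset.card_sigma]
    have hnot : ∀ (e : E) (M : Finset E), l e = x → M.image l = A → ∀ f ∈ M, l f ≠ x :=
      fun e M he hM f hf h => hx (by rw [← hM, ← h]; exact Finset.mem_image_of_mem l hf)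
    -- The pair can be recovered because the inserted edge is the only one at the new row `x`.
    refine Finset.card_le_card_of_injOn (fun p => insert p.1 p.2) ?_ ?_
    · rintro ⟨e, M⟩ hp
      simp only [Finset.mem_coe, Finset.mem_sigma, Finset.mem_filter, Finset.mem_univ, true_and,
        mem_satMatchings] at hp ⊢
      obtain ⟨⟨he, heB⟩, hl, hr, hA, hB⟩ := hp
      have hr' : ∀ f ∈ M, r f ∈ B.erase (r e) := fun f hf => hB (Finset.mem_image_of_mem r hf)
      rw [Finset.coe_insert]
      have heM : e ∉ (M : Set E) := fun h => hnot e M he hA e h he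
      refine ⟨(Set.injOn_insert heM).2 ⟨hl, ?_⟩, (Set.injOn_insert heM).2 ⟨hr, ?_⟩, ?_, ?_⟩
      · rintro ⟨f, hf, hfe⟩
        exact hnot e M he hA f hf (hfe.trans he)
      · rintro ⟨f, hf, hfe⟩
        exact Finset.ne_of_mem_erase (hr' f hf) hfe
      · rw [Finset.image_insert, hA, he]
      · rw [Finset.image_insert]
        exact Finset.insert_subset heB (hB.trans (Finset.erase_subset _ _))
    · rintro ⟨e, M⟩ hp ⟨e', M'⟩ hp' heq
      simp only [Finset.mem_coe, Finset.mem_sigma, Finset.mem_filter, Finset.mem_univ, true_and,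
        mem_satMatchings] at hp hp' heq
      have h1 := hnot e M hp.1.1 hp.2.2.2.1
      have h2 := hnot e' M' hp'.1.1 hp'.2.2.2.1
      have he : e = e' := by
        have : e ∈ insert e' M' := heq ▸ Finset.mem_insert_self e M
        exact (Finset.mem_insert.1 this).resolve_right fun h => h2 e h hp.1.1
      subst he
      have hM : M = M' := by
        rw [← Finset.erase_insert (fun h => h1 e h hp.1.1), heq,
          Finset.erase_insert (fun h => h2 e h hp.1.1)]
      rw [hM]

end EdgeCounting

/-! ### Splitting maximum matchings along a deficient set. -/

namespace Bigraph

set_option linter.unusedSectionVars false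

variable {X Y E : Type*} [Fintype X] [Fintype Y] [Fintype E]

lemma mem_nbrSet {G : Bigraph X Y E} {S : Finset X} {y : Y} :
    y ∈ G.nbrSet S ↔ ∃ e, G.left e ∈ S ∧ G.right e = y := by
  classical
  simp only [nbrSet, nbrsX, Finset.mem_biUnion, Finset.mem_filter, Finset.mem_univ, true_and]
  constructor
  · rintro ⟨x, hx, e, rfl, h⟩; exact ⟨e, hx, h⟩
  · rintro ⟨e, hx, h⟩; exact ⟨_, hx, e, rfl, h⟩

lemma isMatching_iff {G : Bigraph X Y E} {M : Finset E} :
    G.IsMatching M ↔ Set.InjOn G.left M ∧ Set.InjOn G.right M := by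
  constructor
  · refine fun h => ⟨fun e he f hf hef => ?_, fun e he f hf hef => ?_⟩ <;> by_contra hne
    · exact (h e he f hf hne).1 hef
    · exact (h e he f hf hne).2 hef
  · exact fun h e he f hf hne => ⟨fun h1 => hne (h.1 he hf h1), fun h1 => hne (h.2 he hf h1)⟩

lemma IsMatching.card_le_matchingNumber {G : Bigraph X Y E} {M : Finset E} (h : G.IsMatching M) :
    M.card ≤ G.matchingNumber := by
  classical
  exact Finset.le_sup (f := Finset.card) (by simpa using h)

lemma exists_isMatching_card_eq (G : Bigraph X Y E) :
    ∃ M, G.IsMatching M ∧ M.card = G.matchingNumber := by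
  classical
  obtain ⟨M, hM, h⟩ := Finset.exists_mem_eq_sup
    (Finset.univ.filter fun M : Finset E => G.IsMatching M)
    ⟨∅, Finset.mem_filter.2 ⟨Finset.mem_univ _, fun e he => absurd he (Finset.notMem_empty e)⟩⟩
    Finset.card
  exact ⟨M, by simpa using hM, by rw [← h, matchingNumber]⟩

/-- The easy direction of the defect form of Hall's theorem. -/
lemma card_add_matchingNumber_le (G : Bigraph X Y E) (T : Finset X) :
    T.card + G.matchingNumber ≤ (G.nbrSet T).card + Fintype.card X := by
  classical
  obtain ⟨M, hM, hc⟩ := G.exists_isMatching_card_eq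
  rw [isMatching_iff] at hM
  have h1 : (M.filter fun e => G.left e ∈ T).card ≤ (G.nbrSet T).card :=
    Finset.card_le_card_of_injOn G.right
      (fun e he => by
        simp only [Finset.coe_filter, Set.mem_ofPred_eq] at he
        exact mem_nbrSet.2 ⟨e, he.2, rfl⟩)
      (hM.2.mono fun e he => by simp only [Finset.coe_filter, Set.mem_ofPred_eq] at he; exact he.1)
  have h2 : (M.filter fun e => ¬ G.left e ∈ T).card ≤ (Finset.univ \ T).card :=
    Finset.card_le_card_of_injOn G.left
      (fun e he => by
        simp only [Finset.coe_filter, Set.mem_ofPred_eq] at he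
        simpa using he.2)
      (hM.1.mono fun e he => by simp only [Finset.coe_filter, Set.mem_ofPred_eq] at he; exact he.1)
  have h3 := Finset.card_filter_add_card_filter_not (s := M) fun e => G.left e ∈ T
  have h4 := Finset.card_sdiff_add_card_eq_card (Finset.subset_univ T)
  rw [Finset.card_univ] at h4
  omega

/-- Combining matchings on both sides of a set attaining the deficiency. -/
lemma card_mul_card_le_numMaximumMatchings (G : Bigraph X Y E) [DecidableEq X] [DecidableEq Y]
    {S : Finset X}
    (h : (G.nbrSet S).card + (Finset.univ \ S).card = G.matchingNumber) :
    (satMatchings G.right G.left (G.nbrSet S) S).card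
      * (satMatchings G.left G.right (Finset.univ \ S) (Finset.univ \ G.nbrSet S)).card
      ≤ G.numMaximumMatchings := by
  classical
  rw [← Finset.card_product, numMaximumMatchings]
  have hcases : ∀ p ∈ satMatchings G.right G.left (G.nbrSet S) S ×ˢ
      satMatchings G.left G.right (Finset.univ \ S) (Finset.univ \ G.nbrSet S),
      (∀ e ∈ p.1, G.left e ∈ S ∧ G.right e ∈ G.nbrSet S) ∧
      (∀ e ∈ p.2, G.left e ∉ S ∧ G.right e ∉ G.nbrSet S) := by
    rintro ⟨M, N⟩ hp
    rw [Finset.mem_product, mem_satMatchings, mem_satMatchings] at hp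
    obtain ⟨⟨-, -, hM, hM'⟩, -, -, hN, hN'⟩ := hp
    refine ⟨fun e he => ⟨hM' (Finset.mem_image_of_mem _ he), ?_⟩, fun e he => ⟨?_, ?_⟩⟩
    · rw [← hM]; exact Finset.mem_image_of_mem _ he
    · have : G.left e ∈ Finset.univ \ S := hN ▸ Finset.mem_image_of_mem _ he
      simpa using this
    · simpa using hN' (Finset.mem_image_of_mem _ he)
  refine Finset.card_le_card_of_injOn (fun p => p.1 ∪ p.2) ?_ ?_
  · rintro ⟨M, N⟩ hp
    obtain ⟨h1, h2⟩ := hcases _ hp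
    rw [Finset.mem_coe, Finset.mem_product, mem_satMatchings, mem_satMatchings] at hp
    obtain ⟨⟨hMr, hMl, hM, -⟩, hNl, hNr, hN, -⟩ := hp
    dsimp only at h1 h2 hMr hMl hM hNl hNr hN
    have hdisj : Disjoint M N :=
      Finset.disjoint_left.2 fun e he he' => (h2 e he').1 (h1 e he).1
    have hmatch : G.IsMatching (M ∪ N) := by
      rw [isMatching_iff]
      constructor <;> intro e he f hf hef <;>
        rcases Finset.mem_union.1 (Finset.mem_coe.1 he) with he | he <;>
        rcases Finset.mem_union.1 (Finset.mem_coe.1 hf) with hf | hf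
      · exact hMl he hf hef
      · exact absurd (hef ▸ (h1 e he).1) (h2 f hf).1
      · exact absurd (hef ▸ (h1 f hf).1) (h2 e he).1
      · exact hNl he hf hef
      · exact hMr he hf hef
      · exact absurd (hef ▸ (h1 e he).2) (h2 f hf).2
      · exact absurd (hef ▸ (h1 f hf).2) (h2 e he).2
      · exact hNr he hf hef
    have hcard : (M ∪ N).card = G.matchingNumber := by
      rw [Finset.card_union_of_disjoint hdisj, ← Finset.card_image_of_injOn hMr,
        ← Finset.card_image_of_injOn hNl, hM, hN, h]
    simp only [Finset.coe_filter, Finset.mem_univ, true_and, Set.mem_ofPred_eq]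
    exact ⟨hmatch, fun M' hM' => hcard ▸ hM'.card_le_matchingNumber⟩
  · rintro ⟨M, N⟩ hp ⟨M', N'⟩ hp' heq
    obtain ⟨h1, h2⟩ := hcases _ hp
    obtain ⟨h1', h2'⟩ := hcases _ hp'
    dsimp only at heq h1 h2 h1' h2'
    have hfst : ∀ M N : Finset E, (∀ e ∈ M, G.left e ∈ S ∧ G.right e ∈ G.nbrSet S) →
        (∀ e ∈ N, G.left e ∉ S ∧ G.right e ∉ G.nbrSet S) →
        (M ∪ N).filter (fun e => G.left e ∈ S) = M ∧
        (M ∪ N).filter (fun e => ¬ G.left e ∈ S) = N := fun M N hM hN => by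
      constructor <;> ext e <;> simp only [Finset.mem_filter, Finset.mem_union]
      · exact ⟨fun h => h.1.resolve_right fun h' => (hN e h').1 h.2,
          fun h => ⟨Or.inl h, (hM e h).1⟩⟩
      · exact ⟨fun h => h.1.resolve_left fun h' => h.2 (hM e h').1,
          fun h => ⟨Or.inr h, (hN e h).1⟩⟩
    have h3 := hfst M N h1 h2
    have h4 := hfst M' N' h1' h2'
    rw [heq] at h3
    rw [Prod.mk.injEq]
    exact ⟨h3.1.symm.trans h4.1, h3.2.symm.trans h4.2⟩

lemma nb_edgeMult_union (G : Bigraph X Y E) [DecidableEq X] [DecidableEq Y] (S D : Finset X) :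
    (nb (edgeMult G.left G.right) (Finset.univ \ G.nbrSet S) D).card + (G.nbrSet S).card
      = (G.nbrSet (S ∪ D)).card := by
  have h : nb (edgeMult G.left G.right) (Finset.univ \ G.nbrSet S) D
      = G.nbrSet (S ∪ D) \ G.nbrSet S := by
    ext y
    simp only [mem_nb, Finset.mem_sdiff, Finset.mem_univ, true_and, mem_nbrSet, edgeMult_pos,
      Finset.mem_union]
    constructor
    · rintro ⟨hy, x, hx, e, rfl, he⟩
      exact ⟨⟨e, Or.inr hx, he⟩, hy⟩
    · rintro ⟨⟨e, he | he, hey⟩, hy⟩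
      · exact absurd ⟨e, he, hey⟩ hy
      · exact ⟨hy, _, he, e, rfl, hey⟩
  rw [h]
  refine Finset.card_sdiff_add_card_eq_card fun y hy => ?_
  rw [mem_nbrSet] at *
  exact hy.imp fun e he => ⟨Finset.mem_union_left _ he.1, he.2⟩

lemma colNb_edgeMult (G : Bigraph X Y E) [DecidableEq X] [DecidableEq Y] {S T : Finset X}
    (hT : T ⊆ S) : colNb (edgeMult G.right G.left) (G.nbrSet S) T = G.nbrSet T := by
  ext y
  simp only [mem_colNb, mem_nbrSet, edgeMult_pos]
  constructor
  · rintro ⟨-, x, hx, e, he, rfl⟩; exact ⟨e, hx, he⟩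
  · rintro ⟨e, hx, he⟩; exact ⟨⟨e, hT hx, he⟩, _, hx, e, he, rfl⟩

lemma rowNb_edgeMult_eq_nbrsX (G : Bigraph X Y E) [DecidableEq X] [DecidableEq Y] {S : Finset X}
    {x : X} (hx : x ∈ S) : rowNb (edgeMult G.right G.left) (G.nbrSet S) x = G.nbrsX x := by
  ext y
  simp only [mem_rowNb, mem_nbrSet, edgeMult_pos, nbrsX, Finset.mem_filter, Finset.mem_univ,
    true_and]
  constructor
  · rintro ⟨-, e, he, h⟩; exact ⟨e, h, he⟩
  · rintro ⟨e, rfl, he⟩; exact ⟨⟨e, hx, he⟩, e, he, rfl⟩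

lemma rowNb_edgeMult_eq_nbrsY (G : Bigraph X Y E) [DecidableEq X] [DecidableEq Y] {S : Finset X}
    {y : Y} (hy : y ∉ G.nbrSet S) :
    rowNb (edgeMult G.left G.right) (Finset.univ \ S) y = G.nbrsY y := by
  ext x
  simp only [mem_rowNb, edgeMult_pos, nbrsY, Finset.mem_filter, Finset.mem_univ,
    true_and, Finset.mem_sdiff]
  refine ⟨fun h => h.2, fun h => ⟨fun hx => hy ?_, h⟩⟩
  obtain ⟨e, rfl, he⟩ := h
  exact mem_nbrSet.2 ⟨e, hx, he⟩

lemma sum_edgeMult_eq_degX (G : Bigraph X Y E) [DecidableEq X] [DecidableEq Y] {S : Finset X}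
    {x : X} (hx : x ∈ S) : ∑ y ∈ G.nbrSet S, edgeMult G.right G.left y x = G.degX x := by
  rw [Finset.sum_congr rfl fun y _ => edgeMult_swap G.left G.right x y, sum_edgeMult, degX]
  congr 1
  ext e
  simp only [Finset.mem_filter, Finset.mem_univ, true_and, mem_nbrSet]
  exact ⟨fun h => h.1, fun h => ⟨h, e, h ▸ hx, rfl⟩⟩

lemma weightSum_edgeMult_eq (G : Bigraph X Y E) [DecidableEq X] [DecidableEq Y] (S : Finset X)
    (T : Finset Y) : weightSum (edgeMult G.left G.right) (Finset.univ \ S) (Finset.univ \ T)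
      = (G.edgesDelete S T).card := by
  rw [weightSum_edgeMult, edgesDelete]
  congr 1
  ext e
  simp

end Bigraph

theorem corollary4p6 {X Y E : Type*} [Fintype X] [Fintype Y] [Fintype E]
    (G : Bigraph X Y E) (n t r k p n' : ℕ) (b' : ℤ)
    (hn : 1 < n) (ht : 1 < t) (hr : 1 < r)
    (hX : Fintype.card X = n) (hY : Fintype.card Y = n + t)
    (hdeg : ∀ x : X, k ≤ G.degX x)
    (hnbr : ∀ x : X, r ≤ (G.nbrsX x).card)
    (hp : (p : ℤ) = (n : ℤ) - (G.matchingNumber : ℤ))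
    (S : Finset X) (hSne : S.Nonempty)
    (hS : ((G.nbrSet S).card : ℤ) = (S.card : ℤ) - (p : ℤ))
    (hSmax : ∀ T : Finset X,
      ((G.nbrSet T).card : ℤ) = (T.card : ℤ) - (p : ℤ) → T.card ≤ S.card)
    (hleaf : ∀ y : Y, y ∉ G.nbrSet S → 2 ≤ (G.nbrsY y).card)
    (hn' : (n' : ℤ) = (n : ℤ) - (S.card : ℤ))
    (hb' : b' + 2 * ((n' : ℤ) + (t : ℤ) + (p : ℤ))
      = ((G.edgesDelete S (G.nbrSet S)).card : ℤ)) :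
    ((k : ℚ) - (r : ℚ) + 1) * (((r + p).factorial : ℚ) / (p.factorial : ℚ))
        * (((n' : ℚ) - 1) * ((t : ℚ) + (p : ℚ)) + 2 + (b' : ℚ)) * ((t : ℚ) + (p : ℚ) + 1)
      ≤ (G.numMaximumMatchings : ℚ) := by
  classical
  have hA := Finset.card_sdiff_add_card_eq_card (Finset.subset_univ S)
  have hB := Finset.card_sdiff_add_card_eq_card (Finset.subset_univ (G.nbrSet S))
  rw [Finset.card_univ, hX] at hA
  rw [Finset.card_univ, hY] at hB
  have hAn : (Finset.univ \ S).card = n' := by omega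
  have hhall : ∀ T : Finset X, T.card ≤ (G.nbrSet T).card + p := fun T => by
    have := G.card_add_matchingNumber_le T
    omega
  have hprod := G.card_mul_card_le_numMaximumMatchings (S := S) (by omega)
  set Φ₁ := (satMatchings G.right G.left (G.nbrSet S) S).card
  set Φ₂ := (satMatchings G.left G.right (Finset.univ \ S) (Finset.univ \ G.nbrSet S)).card
  -- A set `D` without surplus would make `S ∪ D` a larger set attaining the deficiency.
  have hsur : Surplus (edgeMult G.left G.right) (Finset.univ \ S) (Finset.univ \ G.nbrSet S) 1 := by
    intro D hD hDne
    have h1 := G.nb_edgeMult_union S D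
    have h2 := hhall (S ∪ D)
    have h3 : (S ∪ D).card = S.card + D.card :=
      Finset.card_union_of_disjoint (Finset.disjoint_of_subset_right hD Finset.disjoint_sdiff)
    have h4 := hSmax (S ∪ D)
    have h5 := Finset.card_pos.2 hDne
    omega
  have hlf : Leafless (edgeMult G.left G.right) (Finset.univ \ S) (Finset.univ \ G.nbrSet S) := by
    intro y hy
    have hyS : y ∉ G.nbrSet S := (Finset.mem_sdiff.1 hy).2
    rw [G.rowNb_edgeMult_eq_nbrsY hyS]
    exact hleaf y hyS
  obtain ⟨T, hT⟩ : ∃ T, t + p = T + 1 := ⟨t + p - 1, by omega⟩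
  have h2 := hsur.mul_le_satCount (T := T) (by omega) hlf
  have hcount := satCount_edgeMult_le G.left G.right (Finset.univ \ S) (Finset.univ \ G.nbrSet S)
  have hedge := hlf.two_mul_card_le
  have hn2 := hlf.two_le_card (Finset.card_pos.1 (by omega))
  rw [G.weightSum_edgeMult_eq] at h2 hedge
  rw [hAn] at h2 hn2
  have hBc : ((Finset.univ \ G.nbrSet S).card : ℤ) = n' + t + p := by omega
  have hT' : (T : ℤ) + 1 = t + p := by omega
  have hT'' : (T : ℤ) + 2 = t + p + 1 := by omega
  rw [hBc, hT', hT''] at h2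
  have hbpos : 0 ≤ b' := by omega
  have hfac2 : (((n' : ℤ) - 1) * (t + p) + 2 + b') * (t + p + 1) ≤ Φ₂ := by
    refine le_trans (le_of_eq ?_) (h2.trans (by exact_mod_cast hcount))
    rw [← hb']
    ring
  have hfac2' : (((n' : ℚ) - 1) * (t + p) + 2 + b') * (t + p + 1) ≤ Φ₂ := by exact_mod_cast hfac2
  have hn1 : (0 : ℚ) ≤ (n' : ℚ) - 1 := by
    have : (2 : ℚ) ≤ n' := by exact_mod_cast hn2
    linarith
  have hbq : (0 : ℚ) ≤ b' := by exact_mod_cast hbpos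
  have hnonneg : (0 : ℚ) ≤ (((n' : ℚ) - 1) * (t + p) + 2 + b') * (t + p + 1) := by positivity
  have hprod' : (Φ₁ : ℚ) * Φ₂ ≤ G.numMaximumMatchings := by exact_mod_cast hprod
  rw [mul_assoc]
  -- For `k < r` the factor `k - r + 1` is nonpositive and the other factors are nonnegative, so the
  -- bound is trivial.
  rcases lt_or_ge k r with hkr | hkr
  · have hk0 : (k : ℚ) - r + 1 ≤ 0 := by
      have : (k : ℚ) + 1 ≤ r := by exact_mod_cast hkr
      linarith
    refine le_trans (mul_nonpos_of_nonpos_of_nonneg ?_ hnonneg) (by positivity)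
    exact mul_nonpos_of_nonpos_of_nonneg hk0 (by positivity)
  · obtain ⟨c, rfl⟩ := Nat.exists_eq_add_of_le hkr
    obtain ⟨s, rfl⟩ : ∃ s, r = s + 1 := ⟨r - 1, by omega⟩
    have hcol : ColHall (edgeMult G.right G.left) (G.nbrSet S) S p := fun U hU => by
      rw [G.colNb_edgeMult hU]; exact hhall U
    have h3 := hcol.mul_factorial_le (r := s) (c := c) (by omega) hSne
      (fun x hx => by rw [G.rowNb_edgeMult_eq_nbrsX hx]; exact hnbr x)
      (fun x hx => by
        rw [G.sum_edgeMult_eq_degX hx]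
        have := hdeg x
        omega)
    have hcount₁ := satCount_edgeMult_le G.right G.left (G.nbrSet S) S
    have h4 := h3.trans (Nat.mul_le_mul_right p.factorial hcount₁)
    have h5 : (((c : ℚ) + 1) * ((s + 1 + p).factorial : ℚ)) ≤ Φ₁ * (p.factorial : ℚ) := by
      exact_mod_cast h4
    have hppos : (0 : ℚ) < p.factorial := by exact_mod_cast p.factorial_pos
    have h6 : (((s + 1 + c : ℕ) : ℚ) - ((s + 1 : ℕ) : ℚ) + 1)
        * (((s + 1 + p).factorial : ℚ) / (p.factorial : ℚ)) ≤ Φ₁ := by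
      rw [← mul_div_assoc, div_le_iff₀ hppos]
      refine le_trans (le_of_eq ?_) h5
      push_cast
      ring
    exact (mul_le_mul h6 hfac2' hnonneg (by positivity)).trans hprod'
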